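/- **Setting.** There are $M$ source tasks $1,\dots,M$ and one target task $M+1$. A sample $(x,y)\in\mathbb R^d\times\mathbb R$ of task $m\in\{1,\dots,M+1\}$ satisfies $y=\langle B^{*\top}x,w_m^*\rangle+z$, where $B^*\in\mathbb R^{d\times K}$, $w_m^*\in\mathbb R^K$ and $z\sim\mathcal N(0,\sigma^2)$ is independent of $x$. For every $m$ the law of $x$ is $1$-sub-Gaussian, i.e. $\mathbb E\,e^{\langle v,x-\mathbb E x\rangle}\le e^{\|v\|_2^2/2}$ for all $v\in\mathbb R^d$, and the second-moment matrix $\Sigma=\mathbb E[xx^\top]$ is the same for all tasks and satisfies $\Sigma\succeq\lambda_0 I$ with $\lambda_0>0$. Assume $\sigma\ge\sigma_0>0$, $M\ge K$, and $\sigma_{\min}(W^*)>0$, where $W^*=[w_1^*,\dots,w_M^*]\in\mathbb R^{K\times M}$ and $\sigma_{\min}(W^*)=\min_{\|u\|_2=1}\|W^{*\top}u\|_2$. Let $\nu^*=\arg\min\{\|\nu\|_2:\ W^*\nu=w_{M+1}^*\}$. For $B\in\mathbb R^{d\times K}$ and $w\in\mathbb R^K$ let $L(B,w)=\mathbb E(\langle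 B^\top x,w\rangle-y)^2$ under the target law, and $\mathrm{ER}(B,w)=L(B,w)-L(B^*,w_{M+1}^*)$. **Uniform sampling.** Given a total source budget $N$, draw $n=\lfloor N/M\rfloor$ samples from each source task and $n_{M+1}$ samples from the target task, all independent. From the source data $(X_m,Y_m)_{m\le M}$ compute, as a measurable function of these data, $\hat B$ belonging to a minimiser $(\hat B,\hat W)$ of $\sum_{m=1}^M\|X_mBw_m-Y_m\|_2^2$ over all $B\in\mathbb R^{d\times K}$ and $w_1,\dots,w_M\in\mathbb R^K$ (arbitrary on data for which no minimiser exists), and then let $\hat w_{M+1}$ be any minimiser of $\|X_{M+1}\hat Bw-Y_{M+1}\|_2^2$ over $w\in\mathbb R^K$. **Theorem.** There are universal constants $p\in\mathbb N$ and $C>0$, and for all $\lambda_0,\sigma_0>0$ there is a constant $C_0=C_0(\lambda_0,\sigma_0)>0$, such that the following holds in the above setting, for all $d,K,M$, all $\varepsilon\in(0,1]$ and all $\delta\in(0,1)$. Put $\Lambda=\log(3+K+M+d+1/\varepsilon+N)$. If $N\ge C_0\,M\,(d+\log(M/\delta))$, $$N\ \ge\ C\,\Lambda^p\,\bigl(Kd+KM+\log(1/\delta)\bigr)\,\sigma^2\,M\,\|\nu^*\|_2^2\,\varepsilon^{-2}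 \qquad\text{and}\qquad n_{M+1}\ \ge\ C_0\,\Lambda^p\,\sigma^2\bigl(K+\log(1/\delta)\bigr)\varepsilon^{-2},$$ then, with probability at least $1-\delta$, $\mathrm{ER}(\hat B,\hat w_{M+1})\le\varepsilon^2$. -/

import Mathlib

open MeasureTheory ProbabilityTheory
open scoped Matrix

noncomputable section

namespace RepLearning

/-- Euclidean space `ℝⁿ`. -/
abbrev Vec (n : ℕ) := EuclideanSpace ℝ (Fin n)

/-- The linear representation `x ↦ Bᵀ x`. -/
def rep {d K : ℕ} (B : Matrix (Fin d) (Fin K) ℝ) (x : Vec d) : Vec K :=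
  WithLp.toLp 2 (Bᵀ *ᵥ x.ofLp)

/-- The data of a multi-task linear representation model with `M` source tasks (indices
`0, …, M - 1`) and one target task (the last index `M`): the laws of the inputs, the true
representation matrix, the true linear predictors and the noise level. -/
structure Model (d K M : ℕ) where
  inputLaw : Fin (M + 1) → Measure (Vec d)
  B : Matrix (Fin d) (Fin K) ℝ
  w : Fin (M + 1) → Vec K
  σ : ℝ

/-- A probability law on `ℝᵈ` is `1`-sub-Gaussian: every `⟨v, x - 𝔼 x⟩` has
moment generating function `𝔼 exp (t ⟨v, x - 𝔼 x⟩) ≤ exp (t² ‖v‖² / 2)`. -/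
def OneSubGaussian {d : ℕ} (P : Measure (Vec d)) : Prop :=
  ∀ v : Vec d, HasSubgaussianMGF (fun x => inner ℝ v (x - ∫ y, y ∂P)) (‖v‖₊ ^ 2) P

/-- The second-moment matrix `𝔼 [x xᵀ]`. -/
def secondMoment {d : ℕ} (P : Measure (Vec d)) : Matrix (Fin d) (Fin d) ℝ :=
  Matrix.of fun i j => ∫ x, x i * x j ∂P

/-- The smallest singular value of a `K × M` matrix with `K ≤ M`, that is, the minimum of
`‖Wᵀ u‖₂` over the unit vectors `u ∈ ℝᴷ`. -/
def sigmaMin {K M : ℕ} (W : Matrix (Fin K) (Fin M) ℝ) : ℝ :=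
  sInf {r : ℝ | ∃ u : Vec K, ‖u‖ = 1 ∧ r = ‖rep W u‖}

/-- `log (3 + K + M + d + 1/ε + N)`, the logarithm whose powers `Õ` hides. -/
def logFactor (d K M N : ℕ) (ε : ℝ) : ℝ :=
  Real.log (3 + K + M + d + 1 / ε + N)

/-- The data collected when `n` samples `(x, y)` are drawn from each of the `M` sources. -/
abbrev SourceData (d M n : ℕ) := Fin M → Fin n → Vec d × ℝ

/-- The data of `n` samples `(x, y)` of the target task. -/
abbrev TargetData (d n : ℕ) := Fin n → Vec d × ℝ

/-- `∑ₘ ‖φ(Xₘ) wₘ - Yₘ‖²` for `φ(x) = Bᵀ x`. -/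
def sourceLoss {d K M n : ℕ} (S : SourceData d M n) (B : Matrix (Fin d) (Fin K) ℝ)
    (W : Fin M → Vec K) : ℝ :=
  ∑ m, ∑ i, (inner ℝ (rep B (S m i).1) (W m) - (S m i).2) ^ 2

/-- `‖φ(X) w - Y‖²` on the target sample for `φ(x) = Bᵀ x`. -/
def targetLoss {d K n : ℕ} (T : TargetData d n) (B : Matrix (Fin d) (Fin K) ℝ)
    (w : Vec K) : ℝ :=
  ∑ i, (inner ℝ (rep B (T i).1) w - (T i).2) ^ 2

/-- `(B, W)` is a global minimiser of the multi-task empirical risk. -/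
def IsSourceMinimizer {d K M n : ℕ} (S : SourceData d M n) (B : Matrix (Fin d) (Fin K) ℝ)
    (W : Fin M → Vec K) : Prop :=
  ∀ (B' : Matrix (Fin d) (Fin K) ℝ) (W' : Fin M → Vec K),
    sourceLoss S B W ≤ sourceLoss S B' W'

/-- An empirical risk minimisation rule: a representation `Bhat`, a measurable function of the
source data alone, that is part of a multi-task empirical risk minimiser (on every source data
set for which the minimum is attained), followed by a least-squares predictor `what` on the
target data for this representation. -/
structure IsERM {d K M n nT : ℕ} (Bhat : SourceData d M n → Fin d → Fin K → ℝ)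
    (what : SourceData d M n → TargetData d nT → Vec K) : Prop where
  measurable : Measurable Bhat
  source : ∀ S : SourceData d M n,
    (∃ (B : Matrix (Fin d) (Fin K) ℝ) (W : Fin M → Vec K), IsSourceMinimizer S B W) →
      ∃ W : Fin M → Vec K, IsSourceMinimizer S (Matrix.of (Bhat S)) W
  target : ∀ (S : SourceData d M n) (T : TargetData d nT) (v : Vec K),
    targetLoss T (Matrix.of (Bhat S)) (what S T) ≤ targetLoss T (Matrix.of (Bhat S)) v

namespace Model

variable {d K M : ℕ}

/-- The law of `(x, y)` for task `m`: `y = ⟨Bᵀ x, wₘ⟩ + z` with `z ∼ N(0, σ²)` independent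
of `x`. -/
def taskLaw (μ : Model d K M) (m : Fin (M + 1)) : Measure (Vec d × ℝ) :=
  ((μ.inputLaw m).prod (gaussianReal 0 (μ.σ ^ 2).toNNReal)).map
    fun p => (p.1, inner ℝ (rep μ.B p.1) (μ.w m) + p.2)

/-- The target risk `𝔼 (⟨φ(x), w⟩ - y)²` for `φ(x) = Bᵀ x`. -/
def targetRisk (μ : Model d K M) (B : Matrix (Fin d) (Fin K) ℝ) (w : Vec K) : ℝ :=
  ∫ p, (inner ℝ (rep B p.1) w - p.2) ^ 2 ∂(μ.taskLaw (Fin.last M))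

/-- The excess risk on the target task. -/
def excessRisk (μ : Model d K M) (B : Matrix (Fin d) (Fin K) ℝ) (w : Vec K) : ℝ :=
  μ.targetRisk B w - μ.targetRisk μ.B (μ.w (Fin.last M))

/-- The `K × M` matrix whose columns are the source predictors. -/
def sourceMatrix (μ : Model d K M) : Matrix (Fin K) (Fin M) ℝ :=
  Matrix.of fun k m => μ.w m.castSucc k

/-- `ν` is the minimum-norm solution of `W ν = w_{M+1}`. -/
def IsTaskRelevance (μ : Model d K M) (ν : Vec M) : Prop :=
  μ.sourceMatrix *ᵥ ν.ofLp = (μ.w (Fin.last M)).ofLp ∧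
    ∀ ν' : Vec M, μ.sourceMatrix *ᵥ ν'.ofLp = (μ.w (Fin.last M)).ofLp → ‖ν‖ ≤ ‖ν'‖

/-- The low-dimensional linear representation setting. The inputs of all tasks are
`1`-sub-Gaussian with one common second-moment matrix, whose smallest eigenvalue is at least
`lam₀`; the noise level is at least `σ₀`; the source tasks are diverse. -/
structure IsLinearSetting (μ : Model d K M) (lam₀ σ₀ : ℝ) : Prop where
  isProbabilityMeasure : ∀ m, IsProbabilityMeasure (μ.inputLaw m)
  subGaussian : ∀ m, OneSubGaussian (μ.inputLaw m)
  commonMoment : ∀ m m', secondMoment (μ.inputLaw m) = secondMoment (μ.inputLaw m')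
  moment_lower : ∀ m,
    (secondMoment (μ.inputLaw m) - lam₀ • (1 : Matrix (Fin d) (Fin d) ℝ)).PosSemidef
  noise_lower : σ₀ ≤ μ.σ
  le_sources : K ≤ M
  diverse : 0 < sigmaMin μ.sourceMatrix

/-- The joint law of independent samples, `n` from each source task and `nT` from the target
task. -/
def sampleLaw (μ : Model d K M) (n nT : ℕ) : Measure (SourceData d M n × TargetData d nT) :=
  (Measure.pi fun m : Fin M => Measure.pi fun _ : Fin n => μ.taskLaw m.castSucc).prod
    (Measure.pi fun _ : Fin nT => μ.taskLaw (Fin.last M))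

end Model

end RepLearning

end

/-! Write `θ_m = B* w_m*` and let `e` be a square root of the common matrix `Σ`. Since cross terms
vanish, the excess risk equals `‖e (B w - θ_{M+1})‖²`, so the problem is linear regression in
whitened coordinates, where the second moment is the identity for every task.

Source stage. Once every source design is well conditioned, comparing the empirical minimiser with
the truth bounds `n ∑ ‖Δ_m‖²` by the noise paired with the errors `Δ_m`. All the `Δ_m` lie in one
subspace of dimension at most `2K`, so they factor as `V R_m` with `V` a contraction from `ℝ^{2K}`.
The noise is bilinear in `(V, R)`, and a union bound over two nets costs only `Kd + KM` parameters
(`Model.measure_source_noise_le`). Hence `∑ ‖Δ_m‖² ≲ σ² (Kd + KM + log(1/δ)) / n`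
(`Model.sum_norm_sq_le_of_isSourceMinimizer`).

Transfer. Because `θ_{M+1} = ∑ ν_m θ_m`, the predictor `∑ ν_m ŵ_m` has target error at most `‖ν‖² ∑
‖Δ_m‖²` by Cauchy-Schwarz (`Model.IsTaskRelevance.exists_norm_sq_le`). The minimality of `‖W*ᵀu‖`
never has to be inverted: only the identity for `θ_{M+1}` is needed.

Target stage. `B̂` is independent of the target sample, so conditionally on the source data the
regression lives in a fixed space of dimension `K + 1`. Least squares there loses a constant factor
over the transferred predictor, plus `σ² (K + log(1/δ)) / n_{M+1}`
(`Model.norm_sq_le_of_targetLoss_le`).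

The designs concentrate by a Chernoff bound for products of two marginals
(`IsIsotropic.measure_not_wellConditioned_le`). The noise is controlled by an exponential
supermartingale argument, which is exact for Gaussian noise and needs only the empirical quadratic
variation (`measure_self_normalized_le`). No logarithmic factor arises. -/

namespace RepLearning

/-! ### Nets of unit balls -/

section Nets

variable {E F : Type*} [NormedAddCommGroup E] [NormedSpace ℝ E] [FiniteDimensional ℝ E]
  [NormedAddCommGroup F] [NormedSpace ℝ F] [FiniteDimensional ℝ F]

/-- A finite `1/2`-net of the closed unit ball. -/
structure IsHalfNet (s : Finset E) : Prop where
  norm_le : ∀ y ∈ s, ‖y‖ ≤ 1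
  cover : ∀ x : E, ‖x‖ ≤ 1 → ∃ y ∈ s, ‖x - y‖ ≤ 1 / 2

-- A 1-separated subset of the ball of radius 2 of largest cardinality must be a 1-net of that ball,
-- and volume comparison bounds its size by `5 ^ dim`. Halving it gives the net.
variable (E) in
lemma exists_isHalfNet : ∃ s : Finset E, IsHalfNet s ∧ s.card ≤ 5 ^ Module.finrank ℝ E := by
  classical
  let P : Finset E → Prop := fun s =>
    (∀ c ∈ s, ‖c‖ ≤ 2) ∧ ∀ c ∈ s, ∀ d ∈ s, c ≠ d → 1 ≤ ‖c - d‖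
  have hbd : ∀ s, P s → s.card ≤ 5 ^ Module.finrank ℝ E := fun s hs =>
    Besicovitch.card_le_of_separated s hs.1 hs.2
  obtain ⟨s, hs, hmax⟩ : ∃ s, P s ∧ ∀ t, P t → t.card ≤ s.card := by
    let Q : ℕ → Prop := fun k => ∃ s, P s ∧ s.card = k
    have h0 : Q 0 := ⟨∅, ⟨by simp, by simp⟩, rfl⟩
    obtain ⟨s, hs, hk⟩ := Nat.findGreatest_spec (P := Q) (Nat.zero_le (5 ^ Module.finrank ℝ E)) h0
    refine ⟨s, hs, fun t ht => ?_⟩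
    rw [hk]
    exact Nat.le_findGreatest (hbd t ht) ⟨t, ht, rfl⟩
  refine ⟨s.image fun x => (1 / 2 : ℝ) • x, ⟨?_, ?_⟩, Finset.card_image_le.trans (hbd s hs)⟩
  · intro y hy
    obtain ⟨x, hx, rfl⟩ := Finset.mem_image.1 hy
    have := hs.1 x hx
    rw [norm_smul]
    norm_num
    linarith
  · intro x hx
    have hx2 : ‖(2 : ℝ) • x‖ ≤ 2 := by rw [norm_smul]; norm_num; linarith
    obtain ⟨y, hy, hxy⟩ : ∃ y ∈ s, ‖(2 : ℝ) • x - y‖ < 1 := by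
      by_contra! hcon
      have hnot : (2 : ℝ) • x ∉ s := fun h => by
        have := hcon _ h
        simp at this
        linarith
      have hP : P (insert ((2 : ℝ) • x) s) := by
        refine ⟨?_, ?_⟩
        · intro c hc
          rcases Finset.mem_insert.1 hc with rfl | hc
          · exact hx2
          · exact hs.1 c hc
        · intro c hc d hd hcd
          rcases Finset.mem_insert.1 hc with rfl | hc <;> rcases Finset.mem_insert.1 hd with rfl | hd
          · exact absurd rfl hcd
          · exact hcon d hd
          · rw [norm_sub_rev]; exact hcon c hc
          · exact hs.2 c hc d hd hcd
      have := hmax _ hP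
      rw [Finset.card_insert_of_notMem hnot] at this
      omega
    refine ⟨(1 / 2 : ℝ) • y, Finset.mem_image_of_mem _ hy, ?_⟩
    have : x - (1 / 2 : ℝ) • y = (1 / 2 : ℝ) • ((2 : ℝ) • x - y) := by
      rw [smul_sub, smul_smul]; norm_num
    rw [this, norm_smul]
    norm_num
    linarith

/-- If the maximum `m` over the unit ball is attained at `z`, and `y` is a net point near `z`, then
`m = f y + f (z - y) ≤ a + m / 2`. -/
lemma IsHalfNet.linear_le {s : Finset E} (hs : IsHalfNet s) (f : E →ₗ[ℝ] ℝ) {a : ℝ}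
    (h : ∀ y ∈ s, f y ≤ a) (x : E) : f x ≤ 2 * a * ‖x‖ := by
  have hcont : Continuous f := f.continuous_of_finiteDimensional
  obtain ⟨z, hz, hmax⟩ := (isCompact_closedBall (0 : E) 1).exists_isMaxOn
    ⟨0, by simp⟩ hcont.continuousOn
  have hz1 : ‖z‖ ≤ 1 := by simpa using hz
  have hle : ∀ y, ‖y‖ ≤ 1 → f y ≤ f z := fun y hy => hmax (by simpa using hy)
  have hscale : ∀ y, f y ≤ f z * ‖y‖ := by
    intro y
    rcases eq_or_ne y 0 with rfl | hy
    · simp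
    have hy' : 0 < ‖y‖ := norm_pos_iff.2 hy
    have := hle (‖y‖⁻¹ • y) (by rw [norm_smul, norm_inv, norm_norm, inv_mul_cancel₀ hy'.ne'])
    rw [map_smul, smul_eq_mul, inv_mul_le_iff₀ hy'] at this
    linarith
  obtain ⟨y, hy, hzy⟩ := hs.cover z hz1
  have h0 : 0 ≤ f z := by simpa using hle 0 (by simp)
  have h1 : f z = f y + f (z - y) := by rw [map_sub]; ring
  have h2 := hscale (z - y)
  have h3 := h y hy
  have h4 : f z * ‖z - y‖ ≤ f z * (1 / 2) := mul_le_mul_of_nonneg_left hzy h0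
  have h5 : f z ≤ 2 * a := by linarith
  exact (hscale x).trans (mul_le_mul_of_nonneg_right h5 (norm_nonneg x))

lemma IsHalfNet.bilinear_le {s : Finset E} {t : Finset F} (hs : IsHalfNet s) (ht : IsHalfNet t)
    (f : E →ₗ[ℝ] F →ₗ[ℝ] ℝ) {a : ℝ} (h : ∀ x ∈ s, ∀ y ∈ t, f x y ≤ a) (x : E) (y : F) :
    f x y ≤ 4 * a * ‖x‖ * ‖y‖ := by
  have h1 : ∀ x ∈ s, f.flip y x ≤ 2 * a * ‖y‖ := fun x hx => ht.linear_le (f x) (h x hx) y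
  have := hs.linear_le (f.flip y) h1 x
  rw [LinearMap.flip_apply] at this
  linarith

end Nets

/-! ### Products of independent factors -/

section Products

open scoped ENNReal

variable {ι : Type*} [Fintype ι] {Ω : ι → Type*} [∀ i, MeasurableSpace (Ω i)]

lemma lintegral_pi_prod (P : ∀ i, Measure (Ω i)) [∀ i, IsProbabilityMeasure (P i)]
    (h : ∀ i, Ω i → ℝ≥0∞) (hm : ∀ i, Measurable (h i)) :
    ∫⁻ ω, ∏ i, h i (ω i) ∂(Measure.pi P) = ∏ i, ∫⁻ x, h i x ∂(P i) := by
  have hind : iIndepFun (fun i (ω : ∀ i, Ω i) => h i (ω i)) (Measure.pi P) :=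
    iIndepFun_pi fun i => (hm i).aemeasurable
  rw [lintegral_prod_eq_prod_lintegral_of_indepFun _ _ hind
    fun i => (hm i).comp (measurable_pi_apply i)]
  refine Finset.prod_congr rfl fun i _ => ?_
  exact (measurePreserving_eval P i).lintegral_comp (hm i)

/-- Exponential Markov inequality. -/
lemma measure_le_of_lintegral_exp_le {Ω : Type*} [MeasurableSpace Ω] {P : Measure Ω} {X : Ω → ℝ}
    (hX : Measurable X) {b L : ℝ}
    (h : ∫⁻ ω, ENNReal.ofReal (Real.exp (X ω)) ∂P ≤ ENNReal.ofReal (Real.exp b)) :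
    P {ω | L ≤ X ω} ≤ ENNReal.ofReal (Real.exp (b - L)) := by
  have hM := meas_ge_le_lintegral_div (μ := P) (f := fun ω => ENNReal.ofReal (Real.exp (X ω)))
    (by fun_prop) (ε := ENNReal.ofReal (Real.exp L)) (by simp [Real.exp_pos]) (by simp)
  calc P {ω | L ≤ X ω}
      ≤ P {ω | ENNReal.ofReal (Real.exp L) ≤ ENNReal.ofReal (Real.exp (X ω))} := by
        refine measure_mono fun ω hω => ?_
        exact ENNReal.ofReal_le_ofReal (Real.exp_le_exp.2 hω)
    _ ≤ _ := hM
    _ ≤ ENNReal.ofReal (Real.exp b) / ENNReal.ofReal (Real.exp L) := by gcongr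
    _ = ENNReal.ofReal (Real.exp (b - L)) := by
        rw [← ENNReal.ofReal_div_of_pos (Real.exp_pos _), Real.exp_sub]

end Products

/-! ### Exponential square moments of sub-Gaussian variables -/

section SquareMoment

variable {Ω : Type*} [MeasurableSpace Ω] {P : Measure Ω}

/-- Multiplying the standard Gaussian density by `exp (h² / 4)` gives `√2` times the density of
variance 2. -/
lemma lintegral_exp_sq_gaussian :
    ∫⁻ h, ENNReal.ofReal (Real.exp (h ^ 2 / 4)) ∂(gaussianReal 0 1) = ENNReal.ofReal √2 := by
  rw [gaussianReal_of_var_ne_zero 0 one_ne_zero,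
    lintegral_withDensity_eq_lintegral_mul _ (measurable_gaussianPDF 0 1) (by fun_prop)]
  have : ∀ h : ℝ, (gaussianPDF 0 1 * fun h => ENNReal.ofReal (Real.exp (h ^ 2 / 4))) h
      = ENNReal.ofReal √2 * gaussianPDF 0 2 h := by
    intro h
    simp only [Pi.mul_apply, gaussianPDF, gaussianPDFReal]
    rw [← ENNReal.ofReal_mul (by positivity), ← ENNReal.ofReal_mul (by positivity)]
    congr 1
    have h1 : √(2 * Real.pi * ((2 : NNReal) : ℝ)) = √2 * √(2 * Real.pi) := by
      rw [← Real.sqrt_mul (by norm_num)]; congr 1; push_cast; ring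
    rw [h1, mul_assoc, ← Real.exp_add]
    have h2 : √2 ≠ 0 := by positivity
    have h3 : √(2 * Real.pi) ≠ 0 := by positivity
    push_cast
    field_simp
    congr 1; ring
  simp_rw [this]
  rw [lintegral_const_mul _ (measurable_gaussianPDF 0 2), lintegral_gaussianPDF_eq_one 0 two_ne_zero,
    mul_one]

lemma lintegral_exp_gaussianReal (v : NNReal) (t : ℝ) :
    ∫⁻ h, ENNReal.ofReal (Real.exp (t * h)) ∂(gaussianReal 0 v)
      = ENNReal.ofReal (Real.exp (v * t ^ 2 / 2)) := by
  rw [← ofReal_integral_eq_lintegral_ofReal (integrable_exp_mul_gaussianReal t)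
    (Filter.Eventually.of_forall fun _ => (Real.exp_pos _).le)]
  have := congrFun (mgf_fun_id_gaussianReal (μ := 0) (v := v)) t
  rw [mgf] at this
  rw [this]; simp

/-- The square is linearised by an auxiliary standard Gaussian `h`: `exp (g² / (4κ)) = 𝔼 exp (g h /
√(2κ))`. After exchanging the integrals, the sub-Gaussian bound in `g` leaves `𝔼 exp (h² / 4)`. -/
lemma lintegral_exp_sq_le [SFinite P] {g : Ω → ℝ} {c : NNReal} (hgm : Measurable g)
    (hg : HasSubgaussianMGF g c P) {κ : ℝ} (hκ : 0 < κ) (hc : c ≤ κ) :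
    ∫⁻ ω, ENNReal.ofReal (Real.exp (g ω ^ 2 / (4 * κ))) ∂P ≤ ENNReal.ofReal √2 := by
  set a : ℝ := √(2 * κ) with ha
  have ha0 : 0 < a := Real.sqrt_pos.2 (by positivity)
  have ha2 : a ^ 2 = 2 * κ := Real.sq_sqrt (by positivity)
  have h1 : ∀ ω, ENNReal.ofReal (Real.exp (g ω ^ 2 / (4 * κ)))
      = ∫⁻ h, ENNReal.ofReal (Real.exp (g ω / a * h)) ∂(gaussianReal 0 1) := by
    intro ω
    rw [lintegral_exp_gaussianReal]
    congr 2
    rw [div_pow, ha2]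
    push_cast
    field_simp
    norm_num
  simp_rw [h1]
  rw [lintegral_lintegral_swap (by fun_prop), ← lintegral_exp_sq_gaussian]
  refine lintegral_mono fun h => ?_
  have h2 : ∀ ω, g ω / a * h = h / a * g ω := fun ω => by ring
  simp_rw [h2]
  rw [← ofReal_integral_eq_lintegral_ofReal (hg.integrable_exp_mul _)
    (Filter.Eventually.of_forall fun _ => (Real.exp_pos _).le)]
  refine ENNReal.ofReal_le_ofReal ((hg.mgf_le _).trans (Real.exp_le_exp.2 ?_))
  rw [div_pow, ha2]
  have : (c : ℝ) * (h ^ 2 / (2 * κ)) ≤ κ * (h ^ 2 / (2 * κ)) :=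
    mul_le_mul_of_nonneg_right hc (by positivity)
  have h3 : κ * (h ^ 2 / (2 * κ)) = h ^ 2 / 2 := by field_simp
  linarith

end SquareMoment

/-! ### Isotropic designs -/

section Isotropic

variable {Ω : Type*} [MeasurableSpace Ω]
  {E : Type*} [NormedAddCommGroup E] [InnerProductSpace ℝ E] [FiniteDimensional ℝ E]
  [MeasurableSpace E] [BorelSpace E]

/-- The features `ψ` have second-moment matrix `I` and a uniformly bounded exponential moment of
the squares of their marginals. -/
structure IsIsotropic (P : Measure Ω) (ψ : Ω → E) (s A : ℝ) : Prop where
  measurable : Measurable ψ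
  integrable_sq : ∀ v : E, Integrable (fun ω => inner ℝ v (ψ ω) ^ 2) P
  second_moment : ∀ v : E, ∫ ω, inner ℝ v (ψ ω) ^ 2 ∂P = ‖v‖ ^ 2
  exp_moment : ∀ v : E, ‖v‖ ≤ 1 →
    ∫⁻ ω, ENNReal.ofReal (Real.exp (s * inner ℝ v (ψ ω) ^ 2)) ∂P ≤ ENNReal.ofReal A

/-- The linear term is kept so that it integrates to zero for a centred variable, leaving a
correction quadratic in the tilt. -/
lemma exp_le_one_add_sq (x : ℝ) : Real.exp x ≤ 1 + x + x ^ 2 * Real.exp |x| := by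
  have h1 : 1 ≤ Real.exp |x| := Real.one_le_exp (abs_nonneg x)
  by_cases hx : |x| ≤ 1
  · have := (abs_le.1 (Real.abs_exp_sub_one_sub_id_le hx)).2
    nlinarith [sq_nonneg x]
  · rcases lt_abs.1 (not_le.1 hx) with h | h
    · rw [abs_of_pos (by linarith)]
      have : 1 * Real.exp x ≤ x ^ 2 * Real.exp x :=
        mul_le_mul_of_nonneg_right (by nlinarith) (Real.exp_pos x).le
      linarith
    · have h2 : Real.exp x ≤ 1 := Real.exp_le_one_iff.2 (by linarith)
      nlinarith [sq_nonneg x]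

/-- The second-order constant in the moment generating function of a product of two marginals. -/
noncomputable def expConst (s A : ℝ) : ℝ := 8 / s ^ 2 * Real.exp s * A

/-- The tilting parameter of the Chernoff bound for a product of two marginals. -/
noncomputable def tilt (s A : ℝ) : ℝ := min (s / 2) (1 / (16 * expConst s A))

/-- The exponential rate of concentration of a product of two marginals. -/
noncomputable def rate (s A : ℝ) : ℝ := tilt s A / 16

lemma expConst_pos {s A : ℝ} (hs : 0 < s) (hA : 0 < A) : 0 < expConst s A := by
  unfold expConst; positivity

lemma tilt_pos {s A : ℝ} (hs : 0 < s) (hA : 0 < A) : 0 < tilt s A := by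
  have := expConst_pos hs hA
  unfold tilt; positivity

lemma rate_pos {s A : ℝ} (hs : 0 < s) (hA : 0 < A) : 0 < rate s A := by
  have := tilt_pos hs hA
  unfold rate; positivity

variable {P : Measure Ω} {ψ : Ω → E} {s A : ℝ}

lemma IsIsotropic.integrable_exp (h : IsIsotropic P ψ s A) {v : E} (hv : ‖v‖ ≤ 1) :
    Integrable (fun ω => Real.exp (s * inner ℝ v (ψ ω) ^ 2)) P := by
  have := h.measurable
  refine ⟨by fun_prop, ?_⟩
  rw [hasFiniteIntegral_iff_ofReal (Filter.Eventually.of_forall fun _ => (Real.exp_pos _).le)]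
  exact (h.exp_moment v hv).trans_lt ENNReal.ofReal_lt_top

lemma IsIsotropic.integral_exp_le (h : IsIsotropic P ψ s A) (hA : 0 < A) {v : E}
    (hv : ‖v‖ ≤ 1) : ∫ ω, Real.exp (s * inner ℝ v (ψ ω) ^ 2) ∂P ≤ A := by
  have h1 := h.exp_moment v hv
  rw [← ofReal_integral_eq_lintegral_ofReal (h.integrable_exp hv)
    (Filter.Eventually.of_forall fun _ => (Real.exp_pos _).le)] at h1
  exact (ENNReal.ofReal_le_ofReal_iff hA.le).1 h1

omit [FiniteDimensional ℝ E] [BorelSpace E] in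
lemma IsIsotropic.integrable_mul (h : IsIsotropic P ψ s A) (u v : E) :
    Integrable (fun ω => inner ℝ u (ψ ω) * inner ℝ v (ψ ω)) P := by
  have h1 := (h.integrable_sq (u + v)).const_mul (1 / 4)
  have h2 := (h.integrable_sq (u - v)).const_mul (1 / 4)
  refine (h1.sub h2).congr (Filter.Eventually.of_forall fun ω => ?_)
  simp only [Pi.sub_apply, inner_add_left, inner_sub_left]
  ring

omit [FiniteDimensional ℝ E] [BorelSpace E] in
lemma IsIsotropic.integral_mul (h : IsIsotropic P ψ s A) (u v : E) :
    ∫ ω, inner ℝ u (ψ ω) * inner ℝ v (ψ ω) ∂P = inner ℝ u v := by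
  have h1 := (h.integrable_sq (u + v)).const_mul (1 / 4)
  have h2 := (h.integrable_sq (u - v)).const_mul (1 / 4)
  calc _ = ∫ ω, (1 / 4 * inner ℝ (u + v) (ψ ω) ^ 2 - 1 / 4 * inner ℝ (u - v) (ψ ω) ^ 2) ∂P := by
        congr 1; ext ω; simp only [inner_add_left, inner_sub_left]; ring
    _ = _ := by
        rw [integral_sub h1 h2, integral_const_mul, integral_const_mul, h.second_moment,
          h.second_moment, norm_add_sq_real, norm_sub_sq_real]
        ring

/-- With `y = s|w|/2`, the polynomial factor is absorbed by `y² ≤ 2 exp y`. Then `exp (2y)` splits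
into the two square moments by the arithmetic-geometric mean inequality. -/
lemma sq_mul_exp_le {s w a b : ℝ} (hs : 0 < s) (hw : |w| ≤ (a ^ 2 + b ^ 2) / 2 + 1) :
    w ^ 2 * Real.exp (s / 2 * |w|)
      ≤ 4 / s ^ 2 * Real.exp s * (Real.exp (s * a ^ 2) + Real.exp (s * b ^ 2)) := by
  set y := s / 2 * |w| with hy
  have hy0 : 0 ≤ y := by positivity
  have h1 : y ^ 2 ≤ 2 * Real.exp y := by
    have := Real.quadratic_le_exp_of_nonneg hy0
    nlinarith
  have h2 : w ^ 2 = 4 / s ^ 2 * y ^ 2 := by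
    rw [hy, mul_pow, sq_abs]; field_simp; norm_num
  have h3 : 2 * y ≤ s + (s * a ^ 2 + s * b ^ 2) / 2 := by
    rw [hy]; nlinarith
  have h4 : Real.exp ((s * a ^ 2 + s * b ^ 2) / 2)
      ≤ (Real.exp (s * a ^ 2) + Real.exp (s * b ^ 2)) / 2 := by
    have e1 : Real.exp (s * a ^ 2) = Real.exp (s * a ^ 2 / 2) ^ 2 := by
      rw [← Real.exp_nat_mul]; congr 1; push_cast; ring
    have e2 : Real.exp (s * b ^ 2) = Real.exp (s * b ^ 2 / 2) ^ 2 := by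
      rw [← Real.exp_nat_mul]; congr 1; push_cast; ring
    rw [add_div, Real.exp_add, e1, e2]
    nlinarith [sq_nonneg (Real.exp (s * a ^ 2 / 2) - Real.exp (s * b ^ 2 / 2))]
  have h5 : Real.exp y * Real.exp y
      ≤ Real.exp s * ((Real.exp (s * a ^ 2) + Real.exp (s * b ^ 2)) / 2) := by
    rw [← Real.exp_add, ← two_mul]
    refine (Real.exp_le_exp.2 h3).trans ?_
    rw [Real.exp_add]
    exact mul_le_mul_of_nonneg_left h4 (Real.exp_pos s).le
  calc w ^ 2 * Real.exp y = 4 / s ^ 2 * (y ^ 2 * Real.exp y) := by rw [h2]; ring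
    _ ≤ 4 / s ^ 2 * (2 * (Real.exp s * ((Real.exp (s * a ^ 2) + Real.exp (s * b ^ 2)) / 2))) := by
        refine mul_le_mul_of_nonneg_left ?_ (by positivity)
        nlinarith [Real.exp_pos y]
    _ = _ := by ring

/-- A Chernoff step for the centred product `W`: `𝔼 exp (tW) ≤ 1 + t² D ≤ exp (t² D)`. The choice of
`tilt` gives `tD ≤ 1/16`, so the slack `1/8` leaves `t² D - t/8 ≤ -t/16`, which is minus the rate.
-/
lemma IsIsotropic.lintegral_exp_mul_le [IsProbabilityMeasure P] (h : IsIsotropic P ψ s A)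
    (hs : 0 < s) (hA : 0 < A) {u v : E} (hu : ‖u‖ ≤ 1) (hv : ‖v‖ ≤ 1) :
    ∫⁻ ω, ENNReal.ofReal (Real.exp
        (tilt s A * (inner ℝ u (ψ ω) * inner ℝ v (ψ ω) - inner ℝ u v - 1 / 8))) ∂P
      ≤ ENNReal.ofReal (Real.exp (-rate s A)) := by
  have hm := h.measurable
  set t := tilt s A with ht
  set D := expConst s A with hD
  have hD0 : 0 < D := expConst_pos hs hA
  have ht0 : 0 < t := tilt_pos hs hA
  have hts : t ≤ s / 2 := min_le_left _ _
  have htD : t * D ≤ 1 / 16 := by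
    have : t ≤ 1 / (16 * D) := min_le_right _ _
    rw [le_div_iff₀ (by positivity)] at this
    linarith
  set W : Ω → ℝ := fun ω => inner ℝ u (ψ ω) * inner ℝ v (ψ ω) - inner ℝ u v with hW
  have hWint : Integrable W P := (h.integrable_mul u v).sub (integrable_const _)
  have hW0 : ∫ ω, W ω ∂P = 0 := by
    rw [hW, integral_sub (h.integrable_mul u v) (integrable_const _), h.integral_mul]
    simp
  have hiu := h.integrable_exp hu
  have hiv := h.integrable_exp hv
  set R : Ω → ℝ := fun ω => 4 / s ^ 2 * Real.exp s *
    (Real.exp (s * inner ℝ u (ψ ω) ^ 2) + Real.exp (s * inner ℝ v (ψ ω) ^ 2)) with hR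
  have hRint : Integrable R P := (hiu.add hiv).const_mul _
  have hRle : ∫ ω, R ω ∂P ≤ D := by
    rw [hR, integral_const_mul, integral_add hiu hiv]
    have h1 := h.integral_exp_le hA hu
    have h2 := h.integral_exp_le hA hv
    calc _ ≤ 4 / s ^ 2 * Real.exp s * (A + A) := by gcongr
      _ = D := by rw [hD, expConst]; ring
  have habs : ∀ ω, |W ω| ≤ (inner ℝ u (ψ ω) ^ 2 + inner ℝ v (ψ ω) ^ 2) / 2 + 1 := by
    intro ω
    have h1 : |inner ℝ u (ψ ω) * inner ℝ v (ψ ω)|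
        ≤ (inner ℝ u (ψ ω) ^ 2 + inner ℝ v (ψ ω) ^ 2) / 2 := by
      rw [abs_le]
      constructor
      · nlinarith [sq_nonneg (inner ℝ u (ψ ω) + inner ℝ v (ψ ω))]
      · nlinarith [sq_nonneg (inner ℝ u (ψ ω) - inner ℝ v (ψ ω))]
    have h2 : |inner ℝ u v| ≤ 1 := by
      refine (abs_real_inner_le_norm u v).trans ?_
      nlinarith [norm_nonneg u, norm_nonneg v]
    exact (abs_sub _ _).trans (add_le_add h1 h2)
  have hpt : ∀ ω, Real.exp (t * W ω) ≤ 1 + t * W ω + t ^ 2 * R ω := by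
    intro ω
    refine (exp_le_one_add_sq _).trans ?_
    have h1 := sq_mul_exp_le hs (habs ω)
    have h2 : (t * W ω) ^ 2 * Real.exp |t * W ω|
        ≤ t ^ 2 * (W ω ^ 2 * Real.exp (s / 2 * |W ω|)) := by
      rw [mul_pow, mul_assoc, abs_mul, abs_of_pos ht0]
      gcongr
    have h3 := mul_le_mul_of_nonneg_left h1 (sq_nonneg t)
    linarith
  have hint2 : Integrable (fun ω => 1 + t * W ω + t ^ 2 * R ω) P :=
    ((integrable_const _).add (hWint.const_mul t)).add (hRint.const_mul _)
  have hmain : ∫⁻ ω, ENNReal.ofReal (Real.exp (t * W ω)) ∂P ≤ ENNReal.ofReal (1 + t ^ 2 * D) := by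
    calc _ ≤ ∫⁻ ω, ENNReal.ofReal (1 + t * W ω + t ^ 2 * R ω) ∂P :=
          lintegral_mono fun ω => ENNReal.ofReal_le_ofReal (hpt ω)
      _ = ENNReal.ofReal (∫ ω, (1 + t * W ω + t ^ 2 * R ω) ∂P) :=
          (ofReal_integral_eq_lintegral_ofReal hint2 (Filter.Eventually.of_forall fun ω =>
            (Real.exp_pos _).le.trans (hpt ω))).symm
      _ ≤ _ := by
          refine ENNReal.ofReal_le_ofReal ?_
          have hi : Integrable (fun ω => 1 + t * W ω) P :=
            (integrable_const _).add (hWint.const_mul t)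
          rw [integral_add hi (hRint.const_mul _),
            integral_add (integrable_const _) (hWint.const_mul t), integral_const_mul,
            integral_const_mul, hW0]
          simp only [integral_const, probReal_univ, smul_eq_mul, mul_zero, add_zero, mul_one]
          gcongr
  have hsplit : ∀ ω, ENNReal.ofReal (Real.exp (t * (W ω - 1 / 8)))
      = ENNReal.ofReal (Real.exp (-(t / 8))) * ENNReal.ofReal (Real.exp (t * W ω)) := by
    intro ω
    rw [← ENNReal.ofReal_mul (Real.exp_pos _).le, ← Real.exp_add]
    congr 2; ring
  calc _ = ∫⁻ ω, ENNReal.ofReal (Real.exp (t * (W ω - 1 / 8))) ∂P := rfl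
    _ = ENNReal.ofReal (Real.exp (-(t / 8))) * ∫⁻ ω, ENNReal.ofReal (Real.exp (t * W ω)) ∂P := by
        simp_rw [hsplit]
        rw [lintegral_const_mul _ (by fun_prop)]
    _ ≤ ENNReal.ofReal (Real.exp (-(t / 8))) * ENNReal.ofReal (Real.exp (t ^ 2 * D)) := by
        gcongr
        refine hmain.trans (ENNReal.ofReal_le_ofReal ?_)
        have := Real.add_one_le_exp (t ^ 2 * D)
        linarith
    _ ≤ _ := by
        rw [← ENNReal.ofReal_mul (Real.exp_pos _).le, ← Real.exp_add]
        refine ENNReal.ofReal_le_ofReal (Real.exp_le_exp.2 ?_)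
        rw [rate, ← ht]
        nlinarith

/-- The empirical second-moment form of the sample `ω` is equivalent to the population form on the
subspace `S`. -/
def WellConditioned {n : ℕ} (ψ : Ω → E) (S : Submodule ℝ E) (ω : Fin n → Ω) : Prop :=
  ∀ v ∈ S, n / 2 * ‖v‖ ^ 2 ≤ ∑ i, inner ℝ v (ψ (ω i)) ^ 2 ∧
    ∑ i, inner ℝ v (ψ (ω i)) ^ 2 ≤ 2 * n * ‖v‖ ^ 2

/-- A union bound over pairs of net points, whence `25 = 5²`. The bilinear net argument multiplies
the deviation `n/8` by 4, so the empirical form differs from `n ‖v‖²` by at most `n ‖v‖² / 2`. -/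
theorem IsIsotropic.measure_not_wellConditioned_le [IsProbabilityMeasure P]
    (h : IsIsotropic P ψ s A) (hs : 0 < s) (hA : 0 < A) (S : Submodule ℝ E) (n : ℕ) :
    Measure.pi (fun _ : Fin n => P) {ω | ¬ WellConditioned ψ S ω}
      ≤ ENNReal.ofReal (25 ^ Module.finrank ℝ S * Real.exp (-(rate s A * n))) := by
  have hm := h.measurable
  obtain ⟨N, hN, hcard⟩ := exists_isHalfNet S
  set bad : S × S → Set (Fin n → Ω) := fun p =>
    {ω | 0 ≤ tilt s A * ∑ i, (inner ℝ (p.1 : E) (ψ (ω i)) * inner ℝ (p.2 : E) (ψ (ω i))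
      - inner ℝ (p.1 : E) (p.2 : E) - 1 / 8)} with hbad
  have hbad_le : ∀ p ∈ N ×ˢ N, Measure.pi (fun _ : Fin n => P) (bad p)
      ≤ ENNReal.ofReal (Real.exp (-(rate s A * n))) := by
    rintro ⟨u, v⟩ hp
    obtain ⟨hu, hv⟩ := Finset.mem_product.1 hp
    have := measure_le_of_lintegral_exp_le (P := Measure.pi (fun _ : Fin n => P))
      (X := fun ω => tilt s A * ∑ i, (inner ℝ (u : E) (ψ (ω i)) * inner ℝ (v : E) (ψ (ω i))
      - inner ℝ (u : E) (v : E) - 1 / 8)) (by fun_prop) (b := -(rate s A * n)) (L := 0) ?_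
    · rwa [sub_zero] at this
    · simp_rw [Finset.mul_sum, Real.exp_sum]
      simp_rw [ENNReal.ofReal_prod_of_nonneg fun i _ => (Real.exp_pos _).le]
      rw [lintegral_pi_prod (fun _ : Fin n => P) (fun _ ω => ENNReal.ofReal (Real.exp
        (tilt s A * (inner ℝ (u : E) (ψ ω) * inner ℝ (v : E) (ψ ω) - inner ℝ (u : E) (v : E)
          - 1 / 8)))) (fun _ => by fun_prop)]
      calc _ ≤ ∏ _i : Fin n, ENNReal.ofReal (Real.exp (-rate s A)) :=
            Finset.prod_le_prod' fun i _ =>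
              h.lintegral_exp_mul_le hs hA (hN.norm_le u hu) (hN.norm_le v hv)
        _ = _ := by
          rw [Finset.prod_const, Finset.card_univ, Fintype.card_fin,
            ← ENNReal.ofReal_pow (Real.exp_pos _).le, ← Real.exp_nat_mul]
          congr 2; ring
  have hsub : {ω : Fin n → Ω | ¬ WellConditioned ψ S ω} ⊆ ⋃ p ∈ N ×ˢ N, bad p := by
    intro ω hω
    by_contra hcon
    apply hω
    simp only [Set.mem_iUnion, not_exists] at hcon
    let f : S →ₗ[ℝ] S →ₗ[ℝ] ℝ := LinearMap.mk₂ ℝ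
      (fun u v => ∑ i, inner ℝ (u : E) (ψ (ω i)) * inner ℝ (v : E) (ψ (ω i))
        - n * inner ℝ (u : E) (v : E))
      (fun u u' v => by
        simp only [Submodule.coe_add, inner_add_left, add_mul, Finset.sum_add_distrib]; ring)
      (fun c u v => by
        simp only [Submodule.coe_smul, real_inner_smul_left, smul_eq_mul, mul_sub, Finset.mul_sum]
        congr 1
        · exact Finset.sum_congr rfl fun i _ => by ring
        · ring)
      (fun u v v' => by
        simp only [Submodule.coe_add, inner_add_left, inner_add_right, mul_add,
          Finset.sum_add_distrib]; ring)
      (fun c u v => by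
        simp only [Submodule.coe_smul, real_inner_smul_left, real_inner_smul_right, smul_eq_mul,
          mul_sub, Finset.mul_sum]
        congr 1
        · exact Finset.sum_congr rfl fun i _ => by ring
        · ring)
    have hf : ∀ u v : S, f u v = ∑ i, inner ℝ (u : E) (ψ (ω i)) * inner ℝ (v : E) (ψ (ω i))
        - n * inner ℝ (u : E) (v : E) := fun u v => rfl
    have hnet : ∀ u ∈ N, ∀ v ∈ N, f u v ≤ n / 8 := by
      intro u hu v hv
      have := hcon (u, v) (Finset.mk_mem_product hu hv)
      rw [hbad, Set.mem_ofPred_eq, not_le] at this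
      have h1 := neg_of_mul_neg_right this (tilt_pos hs hA).le
      rw [Finset.sum_sub_distrib, Finset.sum_sub_distrib] at h1
      simp only [Finset.sum_const, Finset.card_univ, Fintype.card_fin, nsmul_eq_mul] at h1
      rw [hf]
      linarith
    intro v hv
    have h1 := hN.bilinear_le hN f hnet ⟨v, hv⟩ ⟨v, hv⟩
    -- The net bound is one-sided; replacing one argument by its negative yields the lower
    -- deviation.
    have h2 := hN.bilinear_le hN f hnet (-⟨v, hv⟩) ⟨v, hv⟩
    rw [map_neg, LinearMap.neg_apply, norm_neg] at h2
    rw [hf] at h1 h2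
    simp only [Submodule.coe_norm, real_inner_self_eq_norm_sq, ← sq] at h1 h2
    have hn : (0 : ℝ) ≤ n * ‖v‖ ^ 2 := by positivity
    constructor <;> nlinarith
  calc _ ≤ Measure.pi (fun _ : Fin n => P) (⋃ p ∈ N ×ˢ N, bad p) := measure_mono hsub
    _ ≤ ∑ p ∈ N ×ˢ N, Measure.pi (fun _ : Fin n => P) (bad p) := measure_biUnion_finset_le _ _
    _ ≤ ∑ p ∈ N ×ˢ N, ENNReal.ofReal (Real.exp (-(rate s A * n))) := Finset.sum_le_sum hbad_le
    _ = ENNReal.ofReal ((N.card * N.card : ℕ) * Real.exp (-(rate s A * n))) := by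
        rw [Finset.sum_const, Finset.card_product, nsmul_eq_mul,
          ENNReal.ofReal_mul (Nat.cast_nonneg _), ENNReal.ofReal_natCast]
    _ ≤ _ := by
        refine ENNReal.ofReal_le_ofReal (mul_le_mul_of_nonneg_right ?_ (Real.exp_pos _).le)
        have h1 : N.card * N.card ≤ 5 ^ Module.finrank ℝ S * 5 ^ Module.finrank ℝ S :=
          Nat.mul_le_mul hcard hcard
        have h2 : 5 ^ Module.finrank ℝ S * 5 ^ Module.finrank ℝ S = 25 ^ Module.finrank ℝ S := by
          rw [← mul_pow]; norm_num
        rw [h2] at h1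
        exact_mod_cast h1

end Isotropic

/-! ### Suprema of the noise process -/

section Noise

variable {d K M : ℕ}

namespace Model

/-- The noise `y - ⟨Bᵀ x, wₘ⟩` of a sample of task `m`. -/
noncomputable def noise (μ : Model d K M) (m : Fin (M + 1)) (p : Vec d × ℝ) : ℝ :=
  p.2 - inner ℝ (rep μ.B p.1) (μ.w m)

end Model

@[fun_prop]
lemma continuous_rep (B : Matrix (Fin d) (Fin K) ℝ) : Continuous (rep B) := by
  unfold rep; fun_prop

namespace Model

variable (μ : Model d K M)

@[fun_prop]
lemma continuous_noise (m : Fin (M + 1)) : Continuous (μ.noise m) := by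
  unfold noise; fun_prop

lemma measurable_sample (m : Fin (M + 1)) : Measurable fun p : Vec d × ℝ =>
    (p.1, inner ℝ (rep μ.B p.1) (μ.w m) + p.2) :=
  Continuous.measurable (by fun_prop)

lemma isProbabilityMeasure_taskLaw {lam₀ σ₀ : ℝ} (h : μ.IsLinearSetting lam₀ σ₀)
    (m : Fin (M + 1)) : IsProbabilityMeasure (μ.taskLaw m) := by
  have := h.isProbabilityMeasure m
  exact Measure.isProbabilityMeasure_map (μ.measurable_sample m).aemeasurable

/-- Given the input `x`, the noise is a centred Gaussian of variance `σ²` and `f x` is a constant,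
so the compensator cancels the moment generating function exactly. -/
lemma lintegral_noise_eq_one (m : Fin (M + 1)) [IsProbabilityMeasure (μ.inputLaw m)]
    {f : Vec d → ℝ} (hf : Measurable f) (t : ℝ) :
    ∫⁻ p, ENNReal.ofReal (Real.exp (t * (μ.noise m p * f p.1) - t ^ 2 * μ.σ ^ 2 / 2 * f p.1 ^ 2))
      ∂(μ.taskLaw m) = 1 := by
  have hn : Measurable (μ.noise m) := (μ.continuous_noise m).measurable
  have hg : Measurable fun p : Vec d × ℝ => ENNReal.ofReal (Real.exp
      (t * (μ.noise m p * f p.1) - t ^ 2 * μ.σ ^ 2 / 2 * f p.1 ^ 2)) := by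
    have hf' : Measurable fun p : Vec d × ℝ => f p.1 := hf.comp measurable_fst
    exact (((hn.mul hf').const_mul t).sub ((hf'.pow_const 2).const_mul _)).exp.ennreal_ofReal
  rw [taskLaw, lintegral_map hg (μ.measurable_sample m),
    lintegral_prod _ (by exact (hg.comp (μ.measurable_sample m)).aemeasurable)]
  have h1 : ∀ x : Vec d, ∫⁻ z, ENNReal.ofReal (Real.exp
      (t * (μ.noise m (x, inner ℝ (rep μ.B x) (μ.w m) + z) * f x)
        - t ^ 2 * μ.σ ^ 2 / 2 * f x ^ 2)) ∂(gaussianReal 0 (μ.σ ^ 2).toNNReal) = 1 := by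
    intro x
    have h2 : ∀ z : ℝ, ENNReal.ofReal (Real.exp
        (t * (μ.noise m (x, inner ℝ (rep μ.B x) (μ.w m) + z) * f x)
          - t ^ 2 * μ.σ ^ 2 / 2 * f x ^ 2))
        = ENNReal.ofReal (Real.exp (-(t ^ 2 * μ.σ ^ 2 / 2 * f x ^ 2)))
          * ENNReal.ofReal (Real.exp (t * f x * z)) := by
      intro z
      rw [← ENNReal.ofReal_mul (Real.exp_pos _).le, ← Real.exp_add]
      congr 2
      simp only [noise]; ring
    simp_rw [h2]
    rw [lintegral_const_mul _ (by fun_prop), lintegral_exp_gaussianReal,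
      ← ENNReal.ofReal_mul (Real.exp_pos _).le, ← Real.exp_add, ← ENNReal.ofReal_one]
    congr 1
    rw [Real.exp_eq_one_iff, Real.coe_toNNReal _ (sq_nonneg _)]
    ring
  simp_rw [h1]
  simp

lemma lintegral_noise_sum_eq_one (m : Fin (M + 1)) [IsProbabilityMeasure (μ.inputLaw m)]
    [IsProbabilityMeasure (μ.taskLaw m)]
    {f : Vec d → ℝ} (hf : Measurable f) (t : ℝ) (n : ℕ) :
    ∫⁻ T : Fin n → Vec d × ℝ, ENNReal.ofReal (Real.exp (t * ∑ i, μ.noise m (T i) * f (T i).1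
      - t ^ 2 * μ.σ ^ 2 / 2 * ∑ i, f (T i).1 ^ 2)) ∂(Measure.pi fun _ => μ.taskLaw m) = 1 := by
  simp_rw [Finset.mul_sum, ← Finset.sum_sub_distrib, Real.exp_sum,
    ENNReal.ofReal_prod_of_nonneg fun i _ => (Real.exp_pos _).le]
  have hn : Measurable (μ.noise m) := (μ.continuous_noise m).measurable
  rw [lintegral_pi_prod (fun _ : Fin n => μ.taskLaw m) (fun _ p => ENNReal.ofReal (Real.exp
    (t * (μ.noise m p * f p.1) - t ^ 2 * μ.σ ^ 2 / 2 * f p.1 ^ 2))) (fun _ => by fun_prop)]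
  simp_rw [μ.lintegral_noise_eq_one m hf t]
  simp

/-- The joint law of the source data. -/
noncomputable def sourceLaw (n : ℕ) : Measure (SourceData d M n) :=
  Measure.pi fun m : Fin M => Measure.pi fun _ : Fin n => μ.taskLaw m.castSucc

/-- The law of the target data. -/
noncomputable def targetLaw (n : ℕ) : Measure (TargetData d n) :=
  Measure.pi fun _ : Fin n => μ.taskLaw (Fin.last M)

lemma lintegral_source_noise_eq_one {lam₀ σ₀ : ℝ} (h : μ.IsLinearSetting lam₀ σ₀)
    {f : Fin M → Vec d → ℝ} (hf : ∀ m, Measurable (f m)) (t : ℝ) (n : ℕ) :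
    ∫⁻ S, ENNReal.ofReal (Real.exp
      (t * ∑ m, ∑ i, μ.noise m.castSucc (S m i) * f m (S m i).1
      - t ^ 2 * μ.σ ^ 2 / 2 * ∑ m, ∑ i, f m (S m i).1 ^ 2)) ∂(μ.sourceLaw n) = 1 := by
  have := h.isProbabilityMeasure
  have := μ.isProbabilityMeasure_taskLaw h
  have hn : ∀ m, Measurable (μ.noise m) := fun m => (μ.continuous_noise m).measurable
  have hexp : ∀ S : SourceData d M n, ENNReal.ofReal (Real.exp
      (t * ∑ m, ∑ i, μ.noise m.castSucc (S m i) * f m (S m i).1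
      - t ^ 2 * μ.σ ^ 2 / 2 * ∑ m, ∑ i, f m (S m i).1 ^ 2))
      = ∏ m, ENNReal.ofReal (Real.exp (t * ∑ i, μ.noise m.castSucc (S m i) * f m (S m i).1
      - t ^ 2 * μ.σ ^ 2 / 2 * ∑ i, f m (S m i).1 ^ 2)) := by
    intro S
    rw [← ENNReal.ofReal_prod_of_nonneg fun i _ => (Real.exp_pos _).le, ← Real.exp_sum,
      Finset.sum_sub_distrib, ← Finset.mul_sum, ← Finset.mul_sum]
  rw [lintegral_congr hexp]
  rw [sourceLaw, lintegral_pi_prod (fun m : Fin M => Measure.pi fun _ : Fin n => μ.taskLaw m.castSucc)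
    (fun m T => ENNReal.ofReal (Real.exp
    (t * ∑ i, μ.noise m.castSucc (T i) * f m (T i).1
      - t ^ 2 * μ.σ ^ 2 / 2 * ∑ i, f m (T i).1 ^ 2))) (fun m => by
        have := hn m.castSucc; have := hf m; fun_prop)]
  exact Finset.prod_eq_one fun m _ => μ.lintegral_noise_sum_eq_one m.castSucc (hf m) t n

end Model

/-- Deviation bound for a martingale-type sum `X` with quadratic variation `Q ≤ q`. -/
lemma measure_self_normalized_le {Ω : Type*} [MeasurableSpace Ω] {P : Measure Ω} {X Q : Ω → ℝ}
    (hX : Measurable X) (hQ : Measurable Q) {σ q L : ℝ} (hσ : 0 < σ) (hq : 0 < q) (hL : 0 < L)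
    (h : ∀ t : ℝ, ∫⁻ ω, ENNReal.ofReal (Real.exp (t * X ω - t ^ 2 * σ ^ 2 / 2 * Q ω)) ∂P = 1) :
    P {ω | Q ω ≤ 2 * q ∧ 2 * σ * √(q * L) < X ω} ≤ ENNReal.ofReal (Real.exp (-L)) := by
  -- This tilt makes the threshold contribute `2L` and the quadratic variation at most `L`, leaving
  -- an exponent of at least `L`.
  set t : ℝ := √L / (σ * √q) with ht
  have hsL : 0 < √L := Real.sqrt_pos.2 hL
  have hsq : 0 < √q := Real.sqrt_pos.2 hq
  have ht0 : 0 < t := by positivity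
  have h1 : t * (2 * σ * √(q * L)) = 2 * L := by
    rw [Real.sqrt_mul hq.le, ht]
    field_simp
    rw [Real.sq_sqrt hL.le]
  have h2 : t ^ 2 * σ ^ 2 * q = L := by
    rw [ht, div_pow, mul_pow, Real.sq_sqrt hL.le, Real.sq_sqrt hq.le]
    field_simp
  have h3 := measure_le_of_lintegral_exp_le (P := P) (b := 0) (L := L)
    (X := fun ω => t * X ω - t ^ 2 * σ ^ 2 / 2 * Q ω) (by fun_prop) (by simp [h t])
  rw [zero_sub] at h3
  refine (measure_mono ?_).trans h3
  rintro ω ⟨hQω, hXω⟩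
  have h4 := mul_lt_mul_of_pos_left hXω ht0
  have h5 : t ^ 2 * σ ^ 2 / 2 * Q ω ≤ t ^ 2 * σ ^ 2 / 2 * (2 * q) :=
    mul_le_mul_of_nonneg_left hQω (by positivity)
  change L ≤ _
  linarith

/-! ### Uniform noise bounds by union over nets -/

section Suprema

variable {E : Type*} [NormedAddCommGroup E] [InnerProductSpace ℝ E] [FiniteDimensional ℝ E]
  [MeasurableSpace E] [BorelSpace E] (μ : Model d K M) {lam₀ σ₀ : ℝ}

/-- Conditioning of the design bounds the quadratic variation at every net point by `2n`. The linear
net argument doubles the pointwise threshold `2σ√(nL)`. -/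
theorem Model.measure_target_noise_le (h : μ.IsLinearSetting lam₀ σ₀) (hσ : 0 < μ.σ)
    {ψ : Vec d → E} (hψ : Measurable ψ) (S : Submodule ℝ E) {n : ℕ} (hn : 0 < n) {L : ℝ}
    (hL : 0 < L) :
    μ.targetLaw n {T | WellConditioned (fun p : Vec d × ℝ => ψ p.1) S T ∧
      ∃ v ∈ S, 4 * μ.σ * √(n * L) * ‖v‖ < ∑ i, μ.noise (Fin.last M) (T i) * inner ℝ v (ψ (T i).1)}
      ≤ ENNReal.ofReal (5 ^ Module.finrank ℝ S * Real.exp (-L)) := by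
  have := h.isProbabilityMeasure (Fin.last M)
  have := μ.isProbabilityMeasure_taskLaw h (Fin.last M)
  have hnm : Measurable (μ.noise (Fin.last M)) := (μ.continuous_noise _).measurable
  obtain ⟨N, hN, hcard⟩ := exists_isHalfNet S
  have hn' : (0 : ℝ) < n := by exact_mod_cast hn
  set bad : S → Set (TargetData d n) := fun v =>
    {T | ∑ i, inner ℝ (v : E) (ψ (T i).1) ^ 2 ≤ 2 * n ∧
      2 * μ.σ * √(n * L) < ∑ i, μ.noise (Fin.last M) (T i) * inner ℝ (v : E) (ψ (T i).1)} with hbad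
  have hbad_le : ∀ v ∈ N, μ.targetLaw n (bad v) ≤ ENNReal.ofReal (Real.exp (-L)) := by
    intro v _
    have hf : Measurable fun x => inner ℝ (v : E) (ψ x) := by fun_prop
    have hX : Measurable fun T : TargetData d n =>
        ∑ i, μ.noise (Fin.last M) (T i) * inner ℝ (v : E) (ψ (T i).1) := by fun_prop
    have hQ : Measurable fun T : TargetData d n => ∑ i, inner ℝ (v : E) (ψ (T i).1) ^ 2 := by
      fun_prop
    have hone := fun t => μ.lintegral_noise_sum_eq_one (Fin.last M) hf t n
    exact measure_self_normalized_le (P := μ.targetLaw n) hX hQ hσ hn' hL hone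
  have hsub : {T : TargetData d n | WellConditioned (fun p : Vec d × ℝ => ψ p.1) S T ∧
      ∃ v ∈ S, 4 * μ.σ * √(n * L) * ‖v‖
        < ∑ i, μ.noise (Fin.last M) (T i) * inner ℝ v (ψ (T i).1)} ⊆ ⋃ v ∈ N, bad v := by
    rintro T ⟨hT, v, hv, hlt⟩
    by_contra hcon
    simp only [Set.mem_iUnion, not_exists] at hcon
    let f : S →ₗ[ℝ] ℝ :=
      { toFun := fun v => ∑ i, μ.noise (Fin.last M) (T i) * inner ℝ (v : E) (ψ (T i).1)
        map_add' := fun u v => by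
          simp only [Submodule.coe_add, inner_add_left, mul_add, Finset.sum_add_distrib]
        map_smul' := fun c u => by
          simp only [Submodule.coe_smul, real_inner_smul_left, smul_eq_mul, RingHom.id_apply,
            Finset.mul_sum]
          exact Finset.sum_congr rfl fun i _ => by ring }
    have hnet : ∀ u ∈ N, f u ≤ 2 * μ.σ * √(n * L) := by
      intro u hu
      by_contra hlt'
      refine hcon u hu ⟨(hT u u.2).2.trans ?_, not_le.1 hlt'⟩
      have h1 : ‖(u : E)‖ ≤ 1 := hN.norm_le u hu
      have h2 : ‖(u : E)‖ ^ 2 ≤ 1 := pow_le_one₀ (norm_nonneg _) h1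
      nlinarith
    have := hN.linear_le f hnet ⟨v, hv⟩
    have h3 : f ⟨v, hv⟩ = ∑ i, μ.noise (Fin.last M) (T i) * inner ℝ v (ψ (T i).1) := rfl
    rw [h3, Submodule.coe_norm] at this
    linarith
  calc _ ≤ μ.targetLaw n (⋃ v ∈ N, bad v) := measure_mono hsub
    _ ≤ ∑ v ∈ N, μ.targetLaw n (bad v) := measure_biUnion_finset_le _ _
    _ ≤ ∑ v ∈ N, ENNReal.ofReal (Real.exp (-L)) := Finset.sum_le_sum hbad_le
    _ = ENNReal.ofReal ((N.card : ℕ) * Real.exp (-L)) := by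
        rw [Finset.sum_const, nsmul_eq_mul, ENNReal.ofReal_mul (Nat.cast_nonneg _),
          ENNReal.ofReal_natCast]
    _ ≤ _ := by
        refine ENNReal.ofReal_le_ofReal (mul_le_mul_of_nonneg_right ?_ (Real.exp_pos _).le)
        exact_mod_cast hcard

omit [MeasurableSpace E] [BorelSpace E] in
variable (E) in
lemma finiteDimensional_clm (r : ℕ) : FiniteDimensional ℝ (Vec r →L[ℝ] E) :=
  LinearEquiv.finiteDimensional (LinearMap.toContinuousLinearMap (E := Vec r) (F' := E) (𝕜 := ℝ))

omit [MeasurableSpace E] [BorelSpace E] in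
variable (E) in
lemma finrank_clm (r : ℕ) : Module.finrank ℝ (Vec r →L[ℝ] E) = r * Module.finrank ℝ E := by
  rw [← LinearEquiv.finrank_eq
    (LinearMap.toContinuousLinearMap (E := Vec r) (F' := E) (𝕜 := ℝ)),
    Module.finrank_linearMap, finrank_euclideanSpace_fin]

lemma finrank_piLp_vec (M r : ℕ) :
    Module.finrank ℝ (PiLp 2 fun _ : Fin M => Vec r) = M * r := by
  rw [LinearEquiv.finrank_eq (WithLp.linearEquiv 2 ℝ (Fin M → Vec r)), Module.finrank_pi_fintype]
  simp

/-- The noise process of the source data at the vectors `V rₘ`. -/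
noncomputable def Model.sourceNoise {n r : ℕ} (ψ : Vec d → E) (S : SourceData d M n)
    (V : Vec r →L[ℝ] E) (R : PiLp 2 fun _ : Fin M => Vec r) : ℝ :=
  ∑ m, ∑ i, μ.noise m.castSucc (S m i) * inner ℝ (V (R m)) (ψ (S m i).1)

section Bilinear

omit [FiniteDimensional ℝ E] [MeasurableSpace E] [BorelSpace E]

variable {n r : ℕ} (ψ : Vec d → E) (S : SourceData d M n)

lemma Model.sourceNoise_add_left (V V' : Vec r →L[ℝ] E) (R : PiLp 2 fun _ : Fin M => Vec r) :
    μ.sourceNoise ψ S (V + V') R = μ.sourceNoise ψ S V R + μ.sourceNoise ψ S V' R := by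
  simp only [sourceNoise, ← Finset.sum_add_distrib]
  refine Finset.sum_congr rfl fun m _ => Finset.sum_congr rfl fun i _ => ?_
  rw [add_apply, inner_add_left, mul_add]

lemma Model.sourceNoise_smul_left (c : ℝ) (V : Vec r →L[ℝ] E)
    (R : PiLp 2 fun _ : Fin M => Vec r) :
    μ.sourceNoise ψ S (c • V) R = c • μ.sourceNoise ψ S V R := by
  simp only [sourceNoise, smul_eq_mul, Finset.mul_sum]
  refine Finset.sum_congr rfl fun m _ => Finset.sum_congr rfl fun i _ => ?_
  rw [smul_apply, real_inner_smul_left]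
  ring

lemma Model.sourceNoise_add_right (V : Vec r →L[ℝ] E) (R R' : PiLp 2 fun _ : Fin M => Vec r) :
    μ.sourceNoise ψ S V (R + R') = μ.sourceNoise ψ S V R + μ.sourceNoise ψ S V R' := by
  simp only [sourceNoise, ← Finset.sum_add_distrib]
  refine Finset.sum_congr rfl fun m _ => Finset.sum_congr rfl fun i _ => ?_
  rw [PiLp.add_apply, map_add, inner_add_left, mul_add]

lemma Model.sourceNoise_smul_right (c : ℝ) (V : Vec r →L[ℝ] E)
    (R : PiLp 2 fun _ : Fin M => Vec r) :
    μ.sourceNoise ψ S V (c • R) = c • μ.sourceNoise ψ S V R := by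
  simp only [sourceNoise, smul_eq_mul, Finset.mul_sum]
  refine Finset.sum_congr rfl fun m _ => Finset.sum_congr rfl fun i _ => ?_
  rw [PiLp.smul_apply, map_smul, real_inner_smul_left]
  ring

end Bilinear

/-- The nets live in the operator-norm ball for `V` and the `ℓ²` ball for `R`, so the entropy is `r
· dim E + M r` rather than the `M · dim E` of unrelated tasks. Contractivity of `V` keeps the
quadratic variation below `2n`, and the bilinear net argument costs a factor 4. -/
theorem Model.measure_source_noise_le (h : μ.IsLinearSetting lam₀ σ₀) (hσ : 0 < μ.σ)
    {ψ : Vec d → E} (hψ : Measurable ψ) (r : ℕ) {n : ℕ} (hn : 0 < n) {L : ℝ} (hL : 0 < L) :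
    μ.sourceLaw n {S | (∀ m, WellConditioned (fun p : Vec d × ℝ => ψ p.1) ⊤ (S m)) ∧
      ∃ (V : Vec r →L[ℝ] E) (R : PiLp 2 fun _ : Fin M => Vec r),
        8 * μ.σ * √(n * L) * ‖V‖ * ‖R‖ < μ.sourceNoise ψ S V R}
      ≤ ENNReal.ofReal (5 ^ (r * Module.finrank ℝ E + M * r) * Real.exp (-L)) := by
  have := h.isProbabilityMeasure
  have := μ.isProbabilityMeasure_taskLaw h
  have hnm : ∀ m, Measurable (μ.noise m) := fun m => (μ.continuous_noise m).measurable
  have hfin := finiteDimensional_clm E r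
  have hrank := finrank_clm E r
  have hrank' := finrank_piLp_vec M r
  obtain ⟨N, hN, hcard⟩ := exists_isHalfNet (Vec r →L[ℝ] E)
  obtain ⟨N', hN', hcard'⟩ := exists_isHalfNet (PiLp 2 fun _ : Fin M => Vec r)
  rw [hrank] at hcard
  rw [hrank'] at hcard'
  have hn' : (0 : ℝ) < n := by exact_mod_cast hn
  set bad : (Vec r →L[ℝ] E) × (PiLp 2 fun _ : Fin M => Vec r) → Set (SourceData d M n) :=
    fun p => {S | ∑ m, ∑ i, inner ℝ (p.1 (p.2 m)) (ψ (S m i).1) ^ 2 ≤ 2 * n ∧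
      2 * μ.σ * √(n * L) < μ.sourceNoise ψ S p.1 p.2} with hbad
  have hbad_le : ∀ p ∈ N ×ˢ N', μ.sourceLaw n (bad p) ≤ ENNReal.ofReal (Real.exp (-L)) := by
    intro p _
    have hf : ∀ m, Measurable fun x => inner ℝ (p.1 (p.2 m)) (ψ x) := fun m =>
      measurable_const.inner hψ
    have hX : Measurable fun S : SourceData d M n => μ.sourceNoise ψ S p.1 p.2 := by
      unfold sourceNoise
      refine Finset.measurable_sum _ fun m _ => Finset.measurable_sum _ fun i _ => ?_
      have hS : Measurable fun S : SourceData d M n => S m i :=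
        (measurable_pi_apply i).comp (measurable_pi_apply m)
      exact ((hnm m.castSucc).comp hS).mul ((hf m).comp (measurable_fst.comp hS))
    have hQ : Measurable fun S : SourceData d M n =>
        ∑ m, ∑ i, inner ℝ (p.1 (p.2 m)) (ψ (S m i).1) ^ 2 := by
      refine Finset.measurable_sum _ fun m _ => Finset.measurable_sum _ fun i _ => ?_
      have hS : Measurable fun S : SourceData d M n => (S m i).1 :=
        measurable_fst.comp ((measurable_pi_apply i).comp (measurable_pi_apply m))
      exact ((hf m).comp hS).pow_const 2
    have hone := fun t => μ.lintegral_source_noise_eq_one h hf t n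
    exact measure_self_normalized_le (P := μ.sourceLaw n) hX hQ hσ hn' hL hone
  have hsub : {S : SourceData d M n |
      (∀ m, WellConditioned (fun p : Vec d × ℝ => ψ p.1) ⊤ (S m)) ∧
      ∃ (V : Vec r →L[ℝ] E) (R : PiLp 2 fun _ : Fin M => Vec r),
        8 * μ.σ * √(n * L) * ‖V‖ * ‖R‖ < μ.sourceNoise ψ S V R} ⊆ ⋃ p ∈ N ×ˢ N', bad p := by
    rintro S ⟨hS, V, R, hlt⟩
    by_contra hcon
    simp only [Set.mem_iUnion, not_exists] at hcon
    let f : (Vec r →L[ℝ] E) →ₗ[ℝ] (PiLp 2 fun _ : Fin M => Vec r) →ₗ[ℝ] ℝ :=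
      LinearMap.mk₂ ℝ (fun V R => μ.sourceNoise ψ S V R) (μ.sourceNoise_add_left ψ S)
        (μ.sourceNoise_smul_left ψ S) (μ.sourceNoise_add_right ψ S) (μ.sourceNoise_smul_right ψ S)
    have hnet : ∀ V ∈ N, ∀ R ∈ N', f V R ≤ 2 * μ.σ * √(n * L) := by
      intro V hV R hR
      by_contra hlt'
      refine hcon (V, R) (Finset.mk_mem_product hV hR) ⟨?_, not_le.1 hlt'⟩
      have hV1 := hN.norm_le V hV
      have hR1 := hN'.norm_le R hR
      have h1 : ∀ m, ∑ i, inner ℝ (V (R m)) (ψ (S m i).1) ^ 2 ≤ 2 * n * ‖R m‖ ^ 2 := by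
        intro m
        refine (hS m (V (R m)) trivial).2.trans ?_
        have h2 : ‖V (R m)‖ ≤ ‖R m‖ := by
          have := V.le_of_opNorm_le hV1 (R m)
          linarith
        gcongr
      calc _ ≤ ∑ m, 2 * n * ‖R m‖ ^ 2 := Finset.sum_le_sum fun m _ => h1 m
        _ = 2 * n * ‖R‖ ^ 2 := by rw [← Finset.mul_sum, PiLp.norm_sq_eq_of_L2]
        _ ≤ 2 * n * 1 := by
            gcongr
            exact pow_le_one₀ (norm_nonneg _) hR1
        _ = 2 * n := by ring
    have := hN.bilinear_le hN' f hnet V R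
    have h3 : f V R = μ.sourceNoise ψ S V R := rfl
    rw [h3] at this
    linarith
  calc _ ≤ μ.sourceLaw n (⋃ p ∈ N ×ˢ N', bad p) := measure_mono hsub
    _ ≤ ∑ p ∈ N ×ˢ N', μ.sourceLaw n (bad p) := measure_biUnion_finset_le _ _
    _ ≤ ∑ p ∈ N ×ˢ N', ENNReal.ofReal (Real.exp (-L)) := Finset.sum_le_sum hbad_le
    _ = ENNReal.ofReal ((N.card * N'.card : ℕ) * Real.exp (-L)) := by
        rw [Finset.sum_const, Finset.card_product, nsmul_eq_mul, ENNReal.ofReal_mul (Nat.cast_nonneg _),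
          ENNReal.ofReal_natCast]
    _ ≤ _ := by
        refine ENNReal.ofReal_le_ofReal (mul_le_mul_of_nonneg_right ?_ (Real.exp_pos _).le)
        rw [pow_add]
        exact_mod_cast Nat.mul_le_mul hcard hcard'

end Suprema

end Noise

/-! ### Whitening -/

section Whitening

variable {d K M : ℕ}

/-- The vector `B w`. -/
noncomputable def coef (B : Matrix (Fin d) (Fin K) ℝ) : Vec K →ₗ[ℝ] Vec d := Matrix.toEuclideanLin B

lemma coef_apply (B : Matrix (Fin d) (Fin K) ℝ) (w : Vec K) :
    coef B w = WithLp.toLp 2 (B *ᵥ w.ofLp) := rfl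

lemma inner_rep (B : Matrix (Fin d) (Fin K) ℝ) (x : Vec d) (w : Vec K) :
    inner ℝ (rep B x) w = inner ℝ (coef B w) x := by
  rw [coef_apply, rep, EuclideanSpace.inner_eq_star_dotProduct,
    EuclideanSpace.inner_eq_star_dotProduct]
  simp only [star_trivial]
  rw [Matrix.mulVec_transpose, dotProduct_comm, ← Matrix.dotProduct_mulVec]

lemma exists_linearMap_norm_sq_eq (A : Matrix (Fin d) (Fin d) ℝ) (h : A.PosSemidef) :
    ∃ e : Vec d →ₗ[ℝ] Vec d, ∀ a, ‖e a‖ ^ 2 = a.ofLp ⬝ᵥ A *ᵥ a.ofLp := by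
  obtain ⟨C, rfl⟩ : ∃ C : Matrix (Fin d) (Fin d) ℝ, A = star C * C := by
    open scoped MatrixOrder Matrix.Norms.L2Operator in
    exact CStarAlgebra.nonneg_iff_eq_star_mul_self.mp h.nonneg
  refine ⟨Matrix.toEuclideanLin C, fun a => ?_⟩
  have h1 : Matrix.toEuclideanLin C a = WithLp.toLp 2 (C *ᵥ a.ofLp) := rfl
  rw [← real_inner_self_eq_norm_sq, h1, EuclideanSpace.inner_eq_star_dotProduct,
    ← Matrix.mulVec_mulVec, Matrix.dotProduct_mulVec a.ofLp, Matrix.star_eq_conjTranspose,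
    Matrix.conjTranspose_eq_transpose_of_trivial, Matrix.vecMul_transpose]
  simp

lemma OneSubGaussian.memLp_inner {P : Measure (Vec d)} [IsProbabilityMeasure P]
    (h : OneSubGaussian P) (a : Vec d) : MemLp (fun x => inner ℝ a x) 2 P := by
  have h1 : MemLp (fun x => inner ℝ a (x - ∫ y, y ∂P)) 2 P := by
    simpa using (h a).memLp 2
  have h2 := h1.add (memLp_const (inner ℝ a (∫ y, y ∂P)))
  refine (memLp_congr_ae (Filter.Eventually.of_forall fun x => ?_)).1 h2
  simp [inner_sub_right]

lemma OneSubGaussian.integral_inner_sq {P : Measure (Vec d)} [IsProbabilityMeasure P]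
    (h : OneSubGaussian P) (a : Vec d) :
    ∫ x, inner ℝ a x ^ 2 ∂P = a.ofLp ⬝ᵥ secondMoment P *ᵥ a.ofLp := by
  have hcoord : ∀ i, MemLp (fun x : Vec d => x i) 2 P := fun i => by
    simpa [EuclideanSpace.inner_single_left] using h.memLp_inner (EuclideanSpace.single i (1 : ℝ))
  have hint : ∀ i j, Integrable (fun x : Vec d => x i * x j) P := fun i j =>
    (hcoord i).integrable_mul (hcoord j)
  have h1 : ∀ x : Vec d, inner ℝ a x ^ 2 = ∑ i, ∑ j, a i * a j * (x i * x j) := by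
    intro x
    rw [PiLp.inner_apply, sq, Finset.sum_mul_sum]
    refine Finset.sum_congr rfl fun i _ => Finset.sum_congr rfl fun j _ => ?_
    simp
    ring
  simp_rw [h1]
  rw [integral_finsetSum _ fun i _ => integrable_finsetSum _ fun j _ => (hint i j).const_mul _]
  simp only [dotProduct, Matrix.mulVec, secondMoment, Matrix.of_apply, Finset.mul_sum]
  refine Finset.sum_congr rfl fun i _ => ?_
  rw [integral_finsetSum _ fun j _ => (hint i j).const_mul _]
  refine Finset.sum_congr rfl fun j _ => ?_
  rw [integral_const_mul]
  ring

/-- `e` is a square root of the common second-moment matrix of the inputs. -/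
structure Model.IsWhitening (μ : Model d K M) (lam₀ : ℝ) (e : Vec d ≃ₗ[ℝ] Vec d) : Prop where
  integral_sq : ∀ m a, ∫ x, inner ℝ a x ^ 2 ∂(μ.inputLaw m) = ‖e a‖ ^ 2
  lower : ∀ a, lam₀ * ‖a‖ ^ 2 ≤ ‖e a‖ ^ 2

lemma Model.IsLinearSetting.exists_isWhitening {μ : Model d K M} {lam₀ σ₀ : ℝ}
    (h : μ.IsLinearSetting lam₀ σ₀) (hlam : 0 < lam₀) :
    ∃ e : Vec d ≃ₗ[ℝ] Vec d, μ.IsWhitening lam₀ e := by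
  set S := secondMoment (μ.inputLaw 0) with hS
  have hlow := h.moment_lower 0
  have hpsd : S.PosSemidef := by
    have h1 : (lam₀ • (1 : Matrix (Fin d) (Fin d) ℝ)).PosSemidef :=
      Matrix.PosSemidef.one.smul hlam.le
    have := hlow.add h1
    rwa [sub_add_cancel] at this
  obtain ⟨e, he⟩ := exists_linearMap_norm_sq_eq S hpsd
  have hle : ∀ a, lam₀ * ‖a‖ ^ 2 ≤ ‖e a‖ ^ 2 := by
    intro a
    have h1 := hlow.dotProduct_mulVec_nonneg a.ofLp
    rw [Matrix.sub_mulVec, dotProduct_sub, star_trivial, ← hS, ← he, Matrix.smul_mulVec,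
      Matrix.one_mulVec, dotProduct_smul, smul_eq_mul] at h1
    have h2 : ‖a‖ ^ 2 = a.ofLp ⬝ᵥ a.ofLp := by
      rw [← real_inner_self_eq_norm_sq, EuclideanSpace.inner_eq_star_dotProduct, star_trivial]
    rw [h2]
    linarith
  have hinj : Function.Injective e := by
    rw [← LinearMap.ker_eq_bot, LinearMap.ker_eq_bot']
    intro a ha
    have := hle a
    rw [ha, norm_zero] at this
    have h1 : ‖a‖ ^ 2 ≤ 0 := by
      by_contra hcon
      nlinarith [mul_pos hlam (not_le.1 hcon)]
    exact norm_eq_zero.1 (pow_eq_zero_iff two_ne_zero |>.1 (le_antisymm h1 (sq_nonneg _)))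
  refine ⟨LinearEquiv.ofInjectiveEndo e hinj, fun m a => ?_, fun a => hle a⟩
  have := h.isProbabilityMeasure m
  rw [(h.subGaussian m).integral_inner_sq, h.commonMoment m 0]
  exact (he a).symm

/-- The whitened features: `⟪v, white e x⟫ = ⟪e⁻¹ v, x⟫`. -/
noncomputable def white (e : Vec d ≃ₗ[ℝ] Vec d) : Vec d →ₗ[ℝ] Vec d :=
  LinearMap.adjoint (e.symm : Vec d →ₗ[ℝ] Vec d)

lemma inner_white (e : Vec d ≃ₗ[ℝ] Vec d) (v x : Vec d) :
    inner ℝ v (white e x) = inner ℝ (e.symm v) x := by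
  rw [white, LinearMap.adjoint_inner_right]; rfl

@[fun_prop]
lemma continuous_white (e : Vec d ≃ₗ[ℝ] Vec d) : Continuous (white e) :=
  (white e).continuous_of_finiteDimensional

/-- The inputs need not be centred. Put `κ = 1/λ₀` and `⟪a, x⟫ = g + b` with mean `b`. The centred
part `g` has sub-Gaussian parameter at most `κ`, and averaging `b² ≤ 2⟪a, x⟫² + 2g²` gives `b² ≤ 2 +
16κ`. Then `(g + b)² ≤ 2g² + 2b²` explains the exponent `λ₀/8` and the constant `exp (λ₀/2 + 4)`. -/
lemma OneSubGaussian.lintegral_exp_inner_sq_le {P : Measure (Vec d)} [IsProbabilityMeasure P]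
    (h : OneSubGaussian P) {lam₀ : ℝ} (hlam : 0 < lam₀) {a : Vec d}
    (ha : lam₀ * ‖a‖ ^ 2 ≤ 1) (hsq : ∫ x, inner ℝ a x ^ 2 ∂P ≤ 1) :
    ∫⁻ x, ENNReal.ofReal (Real.exp (lam₀ / 8 * inner ℝ a x ^ 2)) ∂P
      ≤ ENNReal.ofReal (2 * Real.exp (lam₀ / 2 + 4)) := by
  set κ : ℝ := 1 / lam₀ with hκ
  have hκ0 : 0 < κ := by positivity
  set g : Vec d → ℝ := fun x => inner ℝ a (x - ∫ y, y ∂P) with hg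
  set b : ℝ := inner ℝ a (∫ y, y ∂P) with hb
  have hgm : Measurable g := Continuous.measurable (by fun_prop)
  have hfg : ∀ x, inner ℝ a x = g x + b := fun x => by simp [hg, hb, inner_sub_right]
  have hexp := lintegral_exp_sq_le hgm (h a) hκ0 (by
    rw [NNReal.coe_pow, coe_nnnorm, hκ, le_div_iff₀ hlam]; linarith)
  have h2 : √2 ≤ 2 := by rw [Real.sqrt_le_left (by norm_num)]; norm_num
  have hi : Integrable (fun x => Real.exp (g x ^ 2 / (4 * κ))) P := by
    refine ⟨by fun_prop, ?_⟩
    rw [hasFiniteIntegral_iff_ofReal (Filter.Eventually.of_forall fun _ => (Real.exp_pos _).le)]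
    exact hexp.trans_lt ENNReal.ofReal_lt_top
  have hile : ∫ x, Real.exp (g x ^ 2 / (4 * κ)) ∂P ≤ 2 := by
    rw [← ofReal_integral_eq_lintegral_ofReal hi
      (Filter.Eventually.of_forall fun _ => (Real.exp_pos _).le)] at hexp
    exact ((ENNReal.ofReal_le_ofReal_iff (by positivity)).1 hexp).trans h2
  have hfi : Integrable (fun x : Vec d => inner ℝ a x ^ 2) P := (h.memLp_inner a).integrable_sq
  have hbb : b ^ 2 ≤ 2 + 16 * κ := by
    have hpt : ∀ x, b ^ 2 ≤ 2 * inner ℝ a x ^ 2 + 8 * κ * Real.exp (g x ^ 2 / (4 * κ)) := by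
      intro x
      have h3 : g x ^ 2 ≤ 4 * κ * Real.exp (g x ^ 2 / (4 * κ)) := by
        have := Real.add_one_le_exp (g x ^ 2 / (4 * κ))
        have h4 : g x ^ 2 / (4 * κ) ≤ Real.exp (g x ^ 2 / (4 * κ)) := by linarith
        rw [div_le_iff₀ (by positivity)] at h4
        linarith
      rw [hfg x]
      nlinarith [sq_nonneg (2 * g x + b)]
    have := integral_mono (integrable_const (b ^ 2)) ((hfi.const_mul 2).add (hi.const_mul (8 * κ)))
      hpt
    simp only [Pi.add_apply] at this
    rw [integral_add (hfi.const_mul 2) (hi.const_mul (8 * κ)), integral_const_mul,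
      integral_const_mul] at this
    simp only [integral_const, probReal_univ, smul_eq_mul, one_mul] at this
    nlinarith
  have hlk : lam₀ * κ = 1 := by rw [hκ]; field_simp
  have hpt : ∀ x, ENNReal.ofReal (Real.exp (lam₀ / 8 * inner ℝ a x ^ 2))
      ≤ ENNReal.ofReal (Real.exp (lam₀ / 2 + 4)) *
        ENNReal.ofReal (Real.exp (g x ^ 2 / (4 * κ))) := by
    intro x
    rw [← ENNReal.ofReal_mul (Real.exp_pos _).le, ← Real.exp_add]
    refine ENNReal.ofReal_le_ofReal (Real.exp_le_exp.2 ?_)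
    have h3 : g x ^ 2 / (4 * κ) = lam₀ / 4 * g x ^ 2 := by rw [hκ]; field_simp
    rw [h3, hfg x]
    have h4 : lam₀ / 4 * b ^ 2 ≤ lam₀ / 4 * (2 + 16 * κ) := by gcongr
    nlinarith [mul_nonneg hlam.le (sq_nonneg (g x - b))]
  calc _ ≤ ∫⁻ x, ENNReal.ofReal (Real.exp (lam₀ / 2 + 4)) *
        ENNReal.ofReal (Real.exp (g x ^ 2 / (4 * κ))) ∂P := lintegral_mono hpt
    _ = ENNReal.ofReal (Real.exp (lam₀ / 2 + 4)) *
        ∫⁻ x, ENNReal.ofReal (Real.exp (g x ^ 2 / (4 * κ))) ∂P :=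
        lintegral_const_mul _ (by fun_prop)
    _ ≤ ENNReal.ofReal (Real.exp (lam₀ / 2 + 4)) * ENNReal.ofReal 2 := by
        gcongr
        exact hexp.trans (ENNReal.ofReal_le_ofReal h2)
    _ = _ := by rw [← ENNReal.ofReal_mul (Real.exp_pos _).le, mul_comm]

namespace Model

variable {μ : Model d K M} {lam₀ σ₀ : ℝ} {e : Vec d ≃ₗ[ℝ] Vec d}

/-- The rate of concentration of the empirical second moments in terms of `lam₀`. -/
noncomputable def concentrationRate (lam₀ : ℝ) : ℝ :=
  rate (lam₀ / 8) (2 * Real.exp (lam₀ / 2 + 4))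

lemma concentrationRate_pos (hlam : 0 < lam₀) : 0 < concentrationRate lam₀ :=
  rate_pos (by positivity) (by positivity)

lemma fst_map_taskLaw (m : Fin (M + 1)) :
    (μ.taskLaw m).map Prod.fst = μ.inputLaw m := by
  rw [taskLaw, Measure.map_map measurable_fst (μ.measurable_sample m)]
  exact Measure.fst_prod

/-- For `‖v‖ ≤ 1` the vector `a = e⁻¹ v` satisfies `λ₀ ‖a‖² ≤ ‖v‖² ≤ 1`; this is where the lower
bound on `Σ` makes whitening harmless for the tails. -/
theorem IsWhitening.isIsotropic (he : μ.IsWhitening lam₀ e) (h : μ.IsLinearSetting lam₀ σ₀)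
    (hlam : 0 < lam₀) (m : Fin (M + 1)) :
    IsIsotropic (μ.taskLaw m) (fun p : Vec d × ℝ => white e p.1) (lam₀ / 8)
      (2 * Real.exp (lam₀ / 2 + 4)) := by
  have := h.isProbabilityMeasure m
  have hmp : MeasurePreserving (Prod.fst : Vec d × ℝ → Vec d) (μ.taskLaw m) (μ.inputLaw m) :=
    ⟨measurable_fst, fst_map_taskLaw m⟩
  have hsq : ∀ v : Vec d, ∫ x, inner ℝ (e.symm v) x ^ 2 ∂(μ.inputLaw m) = ‖v‖ ^ 2 := fun v => by
    rw [he.integral_sq, LinearEquiv.apply_symm_apply]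
  refine ⟨Continuous.measurable (by fun_prop), fun v => ?_, fun v => ?_, fun v hv => ?_⟩
  · simp_rw [inner_white]
    exact hmp.integrable_comp_of_integrable ((h.subGaussian m).memLp_inner _).integrable_sq
  · simp_rw [inner_white]
    rw [← hsq v, ← fst_map_taskLaw m, integral_map measurable_fst.aemeasurable
      (Continuous.aestronglyMeasurable (by fun_prop))]
  · simp_rw [inner_white]
    rw [hmp.lintegral_comp (f := fun x => ENNReal.ofReal (Real.exp
      (lam₀ / 8 * inner ℝ (e.symm v) x ^ 2))) (by fun_prop)]
    refine (h.subGaussian m).lintegral_exp_inner_sq_le hlam ?_ ?_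
    · refine (he.lower _).trans ?_
      rw [LinearEquiv.apply_symm_apply]
      exact pow_le_one₀ (norm_nonneg _) hv
    · rw [hsq]
      exact pow_le_one₀ (norm_nonneg _) hv

/-- The true regression vector `B wₘ` of task `m`. -/
noncomputable def theta (μ : Model d K M) (m : Fin (M + 1)) : Vec d := coef μ.B (μ.w m)

lemma IsWhitening.targetRisk_eq (he : μ.IsWhitening lam₀ e) (h : μ.IsLinearSetting lam₀ σ₀)
    (B : Matrix (Fin d) (Fin K) ℝ) (w : Vec K) :
    μ.targetRisk B w = ‖e (coef B w - μ.theta (Fin.last M))‖ ^ 2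
      + ∫ z, z ^ 2 ∂(gaussianReal 0 (μ.σ ^ 2).toNNReal) := by
  have := h.isProbabilityMeasure (Fin.last M)
  set a := coef B w - μ.theta (Fin.last M) with ha
  set G := gaussianReal 0 (μ.σ ^ 2).toNNReal with hG
  have hf : MemLp (fun x => inner ℝ a x) 2 (μ.inputLaw (Fin.last M)) :=
    (h.subGaussian _).memLp_inner a
  have hz : MemLp (fun z : ℝ => z) 2 G := memLp_id_gaussianReal' 2 (by norm_num)
  have i1 : Integrable (fun p : Vec d × ℝ => inner ℝ a p.1 ^ 2)
      ((μ.inputLaw (Fin.last M)).prod G) := hf.integrable_sq.comp_fst G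
  have i2 : Integrable (fun p : Vec d × ℝ => p.2 ^ 2)
      ((μ.inputLaw (Fin.last M)).prod G) := hz.integrable_sq.comp_snd _
  have i3 : Integrable (fun p : Vec d × ℝ => inner ℝ a p.1 * p.2)
      ((μ.inputLaw (Fin.last M)).prod G) :=
    (hf.integrable (by norm_num)).mul_prod (hz.integrable (by norm_num))
  rw [targetRisk, taskLaw, integral_map (μ.measurable_sample _).aemeasurable
    (Continuous.aestronglyMeasurable (by fun_prop))]
  have hpt : ∀ p : Vec d × ℝ, (inner ℝ (rep B p.1) w -
      (inner ℝ (rep μ.B p.1) (μ.w (Fin.last M)) + p.2)) ^ 2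
      = inner ℝ a p.1 ^ 2 - 2 * (inner ℝ a p.1 * p.2) + p.2 ^ 2 := by
    intro p
    rw [inner_rep, inner_rep, ha, inner_sub_left, theta]
    ring
  simp only [hpt]
  have i4 : Integrable (fun p : Vec d × ℝ => inner ℝ a p.1 ^ 2 - 2 * (inner ℝ a p.1 * p.2))
      ((μ.inputLaw (Fin.last M)).prod G) := i1.sub (i3.const_mul 2)
  rw [integral_add i4 i2, integral_sub i1 (i3.const_mul 2),
    integral_const_mul, integral_prod_mul (fun x : Vec d => inner ℝ a x) (fun z : ℝ => z),
    integral_id_gaussianReal, integral_fun_fst (fun x : Vec d => inner ℝ a x ^ 2),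
    integral_fun_snd (fun z : ℝ => z ^ 2), he.integral_sq]
  simp

theorem IsWhitening.excessRisk_eq (he : μ.IsWhitening lam₀ e) (h : μ.IsLinearSetting lam₀ σ₀)
    (B : Matrix (Fin d) (Fin K) ℝ) (w : Vec K) :
    μ.excessRisk B w = ‖e (coef B w - μ.theta (Fin.last M))‖ ^ 2 := by
  rw [excessRisk, he.targetRisk_eq h, he.targetRisk_eq h, theta]
  simp

end Model

end Whitening

/-! ### Empirical risk minimisers -/

section Deterministic

variable {d K M n : ℕ}

/-- Embed `S` isometrically into `ℝʳ` by `J`; then `V = J*` is a contraction with `J* J = 1`, and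
`R_m = J v_m`. This normalisation serves both the compactness argument for minimisers and the noise
bound. -/
lemma exists_factorization {S : Submodule ℝ (Vec d)} {r : ℕ} (hS : Module.finrank ℝ S ≤ r)
    (v : Fin M → Vec d) (hv : ∀ m, v m ∈ S) :
    ∃ (V : Vec r →L[ℝ] Vec d) (R : Fin M → Vec r), ‖V‖ ≤ 1 ∧
      ∀ m, V (R m) = v m ∧ ‖R m‖ = ‖v m‖ := by
  let b := stdOrthonormalBasis ℝ S
  let f : S →ₗ[ℝ] Vec r :=
    b.toBasis.constr ℝ fun i => EuclideanSpace.basisFun (Fin r) ℝ (Fin.castLE hS i)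
  have hf : Orthonormal ℝ (f ∘ b.toBasis) := by
    have h1 : f ∘ b.toBasis = EuclideanSpace.basisFun (Fin r) ℝ ∘ Fin.castLE hS := by
      funext i
      simp only [f, Function.comp_apply, Module.Basis.constr_basis]
    rw [h1]
    exact (EuclideanSpace.basisFun (Fin r) ℝ).orthonormal.comp _ (Fin.castLE_injective hS)
  have hb : Orthonormal ℝ b.toBasis := by simp [b.orthonormal]
  let J : S →ₗᵢ[ℝ] Vec r := f.isometryOfOrthonormal hb hf
  refine ⟨S.subtypeL ∘L ContinuousLinearMap.adjoint J.toContinuousLinearMap,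
    fun m => J ⟨v m, hv m⟩, ?_, fun m => ⟨?_, ?_⟩⟩
  · refine (ContinuousLinearMap.opNorm_comp_le _ _).trans ?_
    rw [LinearIsometryEquiv.norm_map]
    exact mul_le_one₀ S.norm_subtypeL_le (ContinuousLinearMap.opNorm_nonneg _)
      J.norm_toContinuousLinearMap_le
  · have h1 : ContinuousLinearMap.adjoint J.toContinuousLinearMap (J ⟨v m, hv m⟩) = ⟨v m, hv m⟩ := by
      refine ext_inner_left ℝ fun w => ?_
      rw [ContinuousLinearMap.adjoint_inner_right]
      exact J.inner_map_map _ _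
    simp [h1]
  · rw [J.norm_map]; rfl

variable (e : Vec d ≃ₗ[ℝ] Vec d)

lemma inner_rep_eq_white (B : Matrix (Fin d) (Fin K) ℝ) (x : Vec d) (w : Vec K) :
    inner ℝ (rep B x) w = inner ℝ (e (coef B w)) (white e x) := by
  rw [inner_rep, inner_white, LinearEquiv.symm_apply_apply]

/-- The empirical risk of regression vectors in whitened coordinates. -/
noncomputable def whiteLoss (S : SourceData d M n) (u : Fin M → Vec d) : ℝ :=
  ∑ m, ∑ i, (inner ℝ (u m) (white e (S m i).1) - (S m i).2) ^ 2

lemma sourceLoss_eq_whiteLoss (S : SourceData d M n) (B : Matrix (Fin d) (Fin K) ℝ)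
    (W : Fin M → Vec K) : sourceLoss S B W = whiteLoss e S fun m => e (coef B (W m)) := by
  simp only [sourceLoss, whiteLoss, inner_rep_eq_white e]

lemma norm_le_of_whiteLoss_le {S : SourceData d M n} (hn : 0 < n)
    (hS : ∀ m, WellConditioned (fun p : Vec d × ℝ => white e p.1) ⊤ (S m)) {u : Fin M → Vec d}
    (hu : whiteLoss e S u ≤ whiteLoss e S 0) (m : Fin M) :
    ‖u m‖ ≤ √(8 * whiteLoss e S 0 / n) := by
  have hn' : (0 : ℝ) < n := by exact_mod_cast hn
  refine Real.le_sqrt_of_sq_le ?_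
  rw [le_div_iff₀ hn']
  have h1 := (hS m (u m) trivial).1
  have h2 : ∑ i, inner ℝ (u m) (white e (S m i).1) ^ 2
      ≤ ∑ m, ∑ i, inner ℝ (u m) (white e (S m i).1) ^ 2 :=
    Finset.single_le_sum (f := fun m => ∑ i, inner ℝ (u m) (white e (S m i).1) ^ 2)
      (fun m _ => Finset.sum_nonneg fun i _ => sq_nonneg _) (Finset.mem_univ m)
  have h3 : ∑ m, ∑ i, inner ℝ (u m) (white e (S m i).1) ^ 2
      ≤ 2 * whiteLoss e S u + 2 * whiteLoss e S 0 := by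
    simp only [whiteLoss, Finset.mul_sum, ← Finset.sum_add_distrib]
    refine Finset.sum_le_sum fun m _ => Finset.sum_le_sum fun i _ => ?_
    simp only [Pi.zero_apply, inner_zero_left]
    nlinarith [sq_nonneg (inner ℝ (u m) (white e (S m i).1) - 2 * (S m i).2)]
  nlinarith

lemma finrank_map_range_coef_le (B : Matrix (Fin d) (Fin K) ℝ) :
    Module.finrank ℝ ((LinearMap.range (coef B)).map (e : Vec d →ₗ[ℝ] Vec d)) ≤ K := by
  refine (Submodule.finrank_map_le _ _).trans ((LinearMap.finrank_range_le _).trans ?_)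
  rw [finrank_euclideanSpace_fin]

/-- `IsERM` constrains `Bhat` only where a minimum is attained, so attainment has to be proved. The
pairs `(B, W)` are unbounded, but any competitor no worse than zero can be refactored as a
contraction `V` with vectors `R_m` of norm at most `ρ`, and that set is compact. -/
theorem exists_isSourceMinimizer {S : SourceData d M n} (hn : 0 < n)
    (hS : ∀ m, WellConditioned (fun p : Vec d × ℝ => white e p.1) ⊤ (S m)) :
    ∃ (B : Matrix (Fin d) (Fin K) ℝ) (W : Fin M → Vec K), IsSourceMinimizer S B W := by
  have hfin := finiteDimensional_clm (Vec d) K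
  have hproper : ProperSpace (Vec K →L[ℝ] Vec d) := FiniteDimensional.proper_real _
  set ρ := √(8 * whiteLoss e S 0 / n) with hρ
  have hρ0 : 0 ≤ ρ := Real.sqrt_nonneg _
  let F : (Vec K →L[ℝ] Vec d) × (Fin M → Vec K) → ℝ := fun p =>
    whiteLoss e S fun m => p.1 (p.2 m)
  have hF : Continuous F := by
    refine continuous_finsetSum _ fun m _ => continuous_finsetSum _ fun i _ => ?_
    have h1 : Continuous fun p : (Vec K →L[ℝ] Vec d) × (Fin M → Vec K) => p.1 (p.2 m) :=
      isBoundedBilinearMap_apply.continuous.comp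
        (continuous_fst.prodMk ((continuous_apply m).comp continuous_snd))
    exact ((h1.inner continuous_const).sub continuous_const).pow 2
  obtain ⟨⟨V, R⟩, -, hmin⟩ :=
    ((isCompact_closedBall (0 : Vec K →L[ℝ] Vec d) 1).prod
      (isCompact_closedBall (0 : Fin M → Vec K) ρ)).exists_isMinOn
      ⟨(0, 0), by simp [hρ0]⟩ hF.continuousOn
  set B : Matrix (Fin d) (Fin K) ℝ :=
    Matrix.toEuclideanLin.symm ((e.symm : Vec d →ₗ[ℝ] Vec d) ∘ₗ (V : Vec K →ₗ[ℝ] Vec d)) with hB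
  have hcoef : ∀ w, e (coef B w) = V w := by
    intro w
    rw [coef, hB, LinearEquiv.apply_symm_apply]
    simp
  refine ⟨B, R, fun B' W' => ?_⟩
  rw [sourceLoss_eq_whiteLoss e, sourceLoss_eq_whiteLoss e]
  simp only [hcoef]
  by_cases hle : whiteLoss e S (fun m => e (coef B' (W' m))) ≤ whiteLoss e S 0
  · obtain ⟨V', R', hV', hR'⟩ := exists_factorization (finrank_map_range_coef_le e B')
      (fun m => e (coef B' (W' m))) fun m => Submodule.mem_map_of_mem (LinearMap.mem_range_self _ _)
    have hmem : (V', R') ∈ Metric.closedBall (0 : Vec K →L[ℝ] Vec d) 1 ×ˢ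
        Metric.closedBall (0 : Fin M → Vec K) ρ := by
      refine ⟨by simpa using hV', ?_⟩
      rw [mem_closedBall_zero_iff, pi_norm_le_iff_of_nonneg hρ0]
      intro m
      rw [(hR' m).2]
      exact norm_le_of_whiteLoss_le e hn hS hle m
    have h1 : F (V, R) ≤ F (V', R') := hmin hmem
    simpa only [F, hR'] using h1
  -- A competitor worse than the zero predictor loses already to `(0, 0)`, which belongs to the
  -- compact set.
  · have h1 : F (V, R) ≤ F (0, 0) := hmin (by simp [hρ0])
    refine h1.trans (le_of_lt ?_)
    have h2 : F (0, 0) = whiteLoss e S 0 := by simp only [F, zero_apply]; rfl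
    rw [h2]
    exact not_le.1 hle

variable {e}

lemma quadratic_bound {a D q : ℝ} (hq : 0 < q) (hD : 0 ≤ D)
    (h : q / 2 * D ^ 2 ≤ 2 * (a * D)) : D ^ 2 ≤ 16 * a ^ 2 / q ^ 2 := by
  rcases hD.eq_or_lt with rfl | hD
  · rw [zero_pow two_ne_zero]; positivity
  have h1 : q * D ≤ 4 * a := by
    by_contra hcon
    nlinarith [mul_lt_mul_of_pos_right (not_le.1 hcon) hD]
  rw [le_div_iff₀ (by positivity)]
  have h2 : (q * D) ^ 2 ≤ (4 * a) ^ 2 := pow_le_pow_left₀ (by positivity) h1 2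
  nlinarith

/-- The basic inequality of least squares: expanding the comparison with the true parameters gives
`∑ ⟪Δ_m, x⟫² ≤ 2 ∑ z ⟪Δ_m, x⟫`. The errors lie in the sum of the ranges of the estimated and true
representations, so the noise bound with `r = 2K` applies. -/
theorem Model.sum_norm_sq_le_of_isSourceMinimizer (μ : Model d K M) {S : SourceData d M n}
    (hn : 0 < n) (hS : ∀ m, WellConditioned (fun p : Vec d × ℝ => white e p.1) ⊤ (S m))
    {a : ℝ} (hnoise : ∀ (V : Vec (2 * K) →L[ℝ] Vec d) (R : PiLp 2 fun _ : Fin M => Vec (2 * K)),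
      μ.sourceNoise (white e) S V R ≤ a * ‖V‖ * ‖R‖) (ha : 0 ≤ a)
    {B : Matrix (Fin d) (Fin K) ℝ} {W : Fin M → Vec K} (hmin : IsSourceMinimizer S B W) :
    ∑ m, ‖e (coef B (W m) - μ.theta m.castSucc)‖ ^ 2 ≤ 16 * a ^ 2 / n ^ 2 := by
  have hn' : (0 : ℝ) < n := by exact_mod_cast hn
  set Δ : Fin M → Vec d := fun m => e (coef B (W m) - μ.theta m.castSucc) with hΔ
  set T := (LinearMap.range (coef B)).map (e : Vec d →ₗ[ℝ] Vec d) ⊔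
    (LinearMap.range (coef μ.B)).map (e : Vec d →ₗ[ℝ] Vec d) with hT
  have hTrank : Module.finrank ℝ T ≤ 2 * K := by
    have h1 := Submodule.finrank_add_le_finrank_add_finrank
      ((LinearMap.range (coef B)).map (e : Vec d →ₗ[ℝ] Vec d))
      ((LinearMap.range (coef μ.B)).map (e : Vec d →ₗ[ℝ] Vec d))
    have h2 := finrank_map_range_coef_le e B
    have h3 := finrank_map_range_coef_le e μ.B
    rw [← hT] at h1
    omega
  have hΔT : ∀ m, Δ m ∈ T := by
    intro m
    simp only [hΔ, map_sub]
    exact T.sub_mem (Submodule.mem_sup_left (Submodule.mem_map_of_mem (LinearMap.mem_range_self _ _)))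
      (Submodule.mem_sup_right (Submodule.mem_map_of_mem (LinearMap.mem_range_self _ _)))
  obtain ⟨V, R, hV, hR⟩ := exists_factorization hTrank Δ hΔT
  have hbasic := hmin μ.B fun m => μ.w m.castSucc
  have hres : ∀ m i, inner ℝ (rep B (S m i).1) (W m) - (S m i).2
      = inner ℝ (Δ m) (white e (S m i).1) - μ.noise m.castSucc (S m i) := by
    intro m i
    rw [noise, inner_rep_eq_white e, inner_rep_eq_white e, hΔ]
    simp only [map_sub, inner_sub_left, theta]
    ring
  have hres0 : ∀ m i, inner ℝ (rep μ.B (S m i).1) (μ.w m.castSucc) - (S m i).2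
      = -μ.noise m.castSucc (S m i) := fun m i => by rw [noise]; ring
  simp only [sourceLoss, hres, hres0] at hbasic
  have hN : μ.sourceNoise (white e) S V (WithLp.toLp 2 R)
      = ∑ m, ∑ i, μ.noise m.castSucc (S m i) * inner ℝ (Δ m) (white e (S m i).1) := by
    unfold sourceNoise
    simp only [hR]
  have hRnorm : ‖(WithLp.toLp 2 R : PiLp 2 fun _ : Fin M => Vec (2 * K))‖ ^ 2
      = ∑ m, ‖Δ m‖ ^ 2 := by
    rw [PiLp.norm_sq_eq_of_L2]
    simp only [hR]
  have h1 : ∑ m, ∑ i, inner ℝ (Δ m) (white e (S m i).1) ^ 2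
      ≤ 2 * ∑ m, ∑ i, μ.noise m.castSucc (S m i) * inner ℝ (Δ m) (white e (S m i).1) := by
    have h2 : ∀ m i, (inner ℝ (Δ m) (white e (S m i).1) - μ.noise m.castSucc (S m i)) ^ 2
        = inner ℝ (Δ m) (white e (S m i).1) ^ 2
          - 2 * (μ.noise m.castSucc (S m i) * inner ℝ (Δ m) (white e (S m i).1))
          + (-μ.noise m.castSucc (S m i)) ^ 2 := fun m i => by ring
    simp only [h2, Finset.sum_add_distrib, Finset.sum_sub_distrib, ← Finset.mul_sum] at hbasic
    linarith
  rw [← hN] at h1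
  have h3 : (n : ℝ) / 2 * ∑ m, ‖Δ m‖ ^ 2 ≤ ∑ m, ∑ i, inner ℝ (Δ m) (white e (S m i).1) ^ 2 := by
    rw [Finset.mul_sum]
    exact Finset.sum_le_sum fun m _ => (hS m (Δ m) trivial).1
  have h4 := hnoise V (WithLp.toLp 2 R)
  rw [← hRnorm] at h3 ⊢
  refine quadratic_bound hn' (norm_nonneg _) ?_
  have h5 : a * ‖V‖ * ‖(WithLp.toLp 2 R : PiLp 2 fun _ : Fin M => Vec (2 * K))‖
      ≤ a * 1 * ‖(WithLp.toLp 2 R : PiLp 2 fun _ : Fin M => Vec (2 * K))‖ := by gcongr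
  linarith

/-- The linear span, in whitened coordinates, of the columns of `B` and of the true target
regression vector. -/
noncomputable def Model.span (μ : Model d K M) (e : Vec d ≃ₗ[ℝ] Vec d)
    (B : Matrix (Fin d) (Fin K) ℝ) : Vec K × ℝ →ₗ[ℝ] Vec d :=
  (e : Vec d →ₗ[ℝ] Vec d) ∘ₗ
    (coef B).coprod (LinearMap.toSpanSingleton ℝ (Vec d) (μ.theta (Fin.last M)))

lemma Model.span_apply (μ : Model d K M) (B : Matrix (Fin d) (Fin K) ℝ) (q : Vec K × ℝ) :
    μ.span e B q = e (coef B q.1 + q.2 • μ.theta (Fin.last M)) := rfl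

lemma Model.finrank_range_span_le (μ : Model d K M) (B : Matrix (Fin d) (Fin K) ℝ) :
    Module.finrank ℝ (LinearMap.range (μ.span e B)) ≤ K + 1 := by
  refine (LinearMap.finrank_range_le _).trans ?_
  simp

/-- The error splits as `u + r`, with `r` the error of the comparison predictor and `u` the
displacement from it. The misspecification `r` enters only through its empirical norm, so
conditioning is required only on the span of the representation and the true vector. -/
theorem Model.norm_sq_le_of_targetLoss_le (μ : Model d K M) {T : TargetData d n} (hn : 0 < n)
    {B : Matrix (Fin d) (Fin K) ℝ}
    (hT : WellConditioned (fun p : Vec d × ℝ => white e p.1) (LinearMap.range (μ.span e B)) T)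
    {a : ℝ} (hnoise : ∀ v ∈ LinearMap.range (μ.span e B),
      ∑ i, μ.noise (Fin.last M) (T i) * inner ℝ v (white e (T i).1) ≤ a * ‖v‖)
    {w w' : Vec K} (hmin : targetLoss T B w ≤ targetLoss T B w') :
    ‖e (coef B w - μ.theta (Fin.last M))‖ ^ 2
      ≤ 66 * ‖e (coef B w' - μ.theta (Fin.last M))‖ ^ 2 + 128 * a ^ 2 / n ^ 2 := by
  have hn' : (0 : ℝ) < n := by exact_mod_cast hn
  set u : Vec d := e (coef B (w - w')) with hu
  set r : Vec d := e (coef B w' - μ.theta (Fin.last M)) with hr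
  have hur : e (coef B w - μ.theta (Fin.last M)) = u + r := by
    rw [hu, hr, ← map_add]; congr 1; rw [map_sub]; abel
  have humem : u ∈ LinearMap.range (μ.span e B) := ⟨(w - w', 0), by simp [span_apply, hu]⟩
  have hrmem : r ∈ LinearMap.range (μ.span e B) :=
    ⟨(w', -1), by simp [span_apply, hr, sub_eq_add_neg]⟩
  have hres' : ∀ i, inner ℝ (rep B (T i).1) w' - (T i).2
      = inner ℝ r (white e (T i).1) - μ.noise (Fin.last M) (T i) := by
    intro i
    rw [noise, inner_rep_eq_white e, inner_rep_eq_white e, hr]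
    simp only [map_sub, inner_sub_left, theta]
    ring
  have hres : ∀ i, inner ℝ (rep B (T i).1) w - (T i).2
      = inner ℝ u (white e (T i).1) + inner ℝ r (white e (T i).1)
        - μ.noise (Fin.last M) (T i) := by
    intro i
    rw [noise, inner_rep_eq_white e, inner_rep_eq_white e, ← inner_add_left, ← hur]
    simp only [map_sub, inner_sub_left, theta]
    ring
  simp only [targetLoss, hres, hres'] at hmin
  have h1 : ∑ i, inner ℝ u (white e (T i).1) ^ 2
      ≤ 4 * ∑ i, inner ℝ r (white e (T i).1) ^ 2
        + 4 * ∑ i, μ.noise (Fin.last M) (T i) * inner ℝ u (white e (T i).1) := by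
    -- The difference of the two sides is `(u + 2r)²` evaluated on the sample: the cross term is
    -- absorbed into half of the quadratic term.
    have h2 : ∀ i, 2 * ((inner ℝ r (white e (T i).1) - μ.noise (Fin.last M) (T i)) ^ 2
        - (inner ℝ u (white e (T i).1) + inner ℝ r (white e (T i).1)
          - μ.noise (Fin.last M) (T i)) ^ 2) ≤ 4 * inner ℝ r (white e (T i).1) ^ 2
        + 4 * (μ.noise (Fin.last M) (T i) * inner ℝ u (white e (T i).1))
        - inner ℝ u (white e (T i).1) ^ 2 := by
      intro i
      nlinarith [sq_nonneg (inner ℝ u (white e (T i).1) + 2 * inner ℝ r (white e (T i).1))]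
    have h3 := Finset.sum_le_sum fun i (_ : i ∈ Finset.univ) => h2 i
    simp only [Finset.sum_add_distrib, Finset.sum_sub_distrib, ← Finset.mul_sum] at h3
    linarith
  have h4 := (hT u humem).1
  have h5 := (hT r hrmem).2
  have h6 := hnoise u humem
  have h7 : ‖u‖ ^ 2 ≤ 32 * ‖r‖ ^ 2 + 64 * a ^ 2 / n ^ 2 := by
    have h8 : (n : ℝ) ^ 2 * ‖u‖ ^ 2 ≤ n ^ 2 * (32 * ‖r‖ ^ 2) + 64 * a ^ 2 := by
      have h9 : (n : ℝ) / 2 * ‖u‖ ^ 2 ≤ 8 * n * ‖r‖ ^ 2 + 4 * (a * ‖u‖) := by linarith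
      have h10 := mul_le_mul_of_nonneg_left h9 (show (0 : ℝ) ≤ 4 * n by positivity)
      nlinarith [sq_nonneg (n * ‖u‖ - 8 * a)]
    have h11 : ‖u‖ ^ 2 = n ^ 2 * ‖u‖ ^ 2 / n ^ 2 := by field_simp
    rw [h11, div_le_iff₀ (by positivity)]
    calc _ ≤ _ := h8
      _ = _ := by field_simp
  rw [hur]
  have h12 : ‖u + r‖ ^ 2 ≤ 2 * ‖u‖ ^ 2 + 2 * ‖r‖ ^ 2 := by
    have h13 := norm_add_le u r
    have h14 : ‖u + r‖ ^ 2 ≤ (‖u‖ + ‖r‖) ^ 2 := pow_le_pow_left₀ (norm_nonneg _) h13 2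
    nlinarith [sq_nonneg (‖u‖ - ‖r‖)]
  have h15 : 128 * a ^ 2 / (n : ℝ) ^ 2 = 2 * (64 * a ^ 2 / n ^ 2) := by ring
  rw [h15]
  linarith

lemma Model.IsTaskRelevance.theta_eq {μ : Model d K M} {ν : Vec M} (h : μ.IsTaskRelevance ν) :
    μ.theta (Fin.last M) = ∑ m, ν m • μ.theta m.castSucc := by
  have hw : μ.w (Fin.last M) = ∑ m, ν m • μ.w m.castSucc := by
    ext k
    have := congrFun h.1 k
    rw [← this]
    simp [Matrix.mulVec, dotProduct, sourceMatrix, mul_comm]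
  simp only [theta]
  rw [hw, map_sum]
  simp only [map_smul]

lemma norm_sum_smul_sq_le (ν : Vec M) (Δ : Fin M → Vec d) :
    ‖∑ m, ν m • Δ m‖ ^ 2 ≤ ‖ν‖ ^ 2 * ∑ m, ‖Δ m‖ ^ 2 := by
  have h1 : ‖∑ m, ν m • Δ m‖ ≤ ∑ m, ‖ν m‖ * ‖Δ m‖ :=
    (norm_sum_le _ _).trans (Finset.sum_le_sum fun m _ => (norm_smul _ _).le)
  have h2 := pow_le_pow_left₀ (norm_nonneg _) h1 2
  refine h2.trans ((Finset.sum_mul_sq_le_sq_mul_sq _ _ _).trans ?_)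
  rw [EuclideanSpace.norm_sq_eq]

/-- Transfer from the source tasks to the target task along `ν`. -/
lemma Model.IsTaskRelevance.exists_norm_sq_le {μ : Model d K M} {ν : Vec M}
    (h : μ.IsTaskRelevance ν) (B : Matrix (Fin d) (Fin K) ℝ) (W : Fin M → Vec K) :
    ∃ w : Vec K, ‖e (coef B w - μ.theta (Fin.last M))‖ ^ 2
      ≤ ‖ν‖ ^ 2 * ∑ m, ‖e (coef B (W m) - μ.theta m.castSucc)‖ ^ 2 := by
  refine ⟨∑ m, ν m • W m, ?_⟩
  have h1 : e (coef B (∑ m, ν m • W m) - μ.theta (Fin.last M))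
      = ∑ m, ν m • e (coef B (W m) - μ.theta m.castSucc) := by
    rw [h.theta_eq, map_sum, ← Finset.sum_sub_distrib, map_sum]
    refine Finset.sum_congr rfl fun m _ => ?_
    rw [map_smul, ← smul_sub, map_smul]
  rw [h1]
  exact norm_sum_smul_sq_le ν _

end Deterministic

/-! ### High-probability events -/

section Events

variable {d K M n : ℕ} {lam₀ σ₀ : ℝ} {e : Vec d ≃ₗ[ℝ] Vec d}

namespace Model

variable (μ : Model d K M)

lemma isProbabilityMeasure_sourceLaw (h : μ.IsLinearSetting lam₀ σ₀) (n : ℕ) :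
    IsProbabilityMeasure (μ.sourceLaw n) := by
  have := μ.isProbabilityMeasure_taskLaw h
  unfold sourceLaw; infer_instance

lemma isProbabilityMeasure_targetLaw (h : μ.IsLinearSetting lam₀ σ₀) (n : ℕ) :
    IsProbabilityMeasure (μ.targetLaw n) := by
  have := μ.isProbabilityMeasure_taskLaw h
  unfold targetLaw; infer_instance

lemma sampleLaw_eq (n nT : ℕ) : μ.sampleLaw n nT = (μ.sourceLaw n).prod (μ.targetLaw nT) := rfl

/-- The source data on which some design is ill-conditioned or the noise is large. -/
def sourceBad (e : Vec d ≃ₗ[ℝ] Vec d) (a : ℝ) (n : ℕ) : Set (SourceData d M n) :=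
  {S | ¬ ((∀ m, WellConditioned (fun p : Vec d × ℝ => white e p.1) ⊤ (S m)) ∧
    ∀ (V : Vec (2 * K) →L[ℝ] Vec d) (R : PiLp 2 fun _ : Fin M => Vec (2 * K)),
      μ.sourceNoise (white e) S V R ≤ a * ‖V‖ * ‖R‖)}

variable {μ}

lemma IsWhitening.measure_sourceBad_le (he : μ.IsWhitening lam₀ e)
    (h : μ.IsLinearSetting lam₀ σ₀) (hlam : 0 < lam₀) (hσ : 0 < μ.σ) (hn : 0 < n) {L : ℝ}
    (hL : 0 < L) :
    μ.sourceLaw n (μ.sourceBad e (8 * μ.σ * √(n * L)) n)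
      ≤ M * ENNReal.ofReal (25 ^ d * Real.exp (-(concentrationRate lam₀ * n)))
        + ENNReal.ofReal (5 ^ (2 * K * d + M * (2 * K)) * Real.exp (-L)) := by
  have := μ.isProbabilityMeasure_taskLaw h
  have hsub : μ.sourceBad e (8 * μ.σ * √(n * L)) n ⊆
      (⋃ m, {S : SourceData d M n |
        ¬ WellConditioned (fun p : Vec d × ℝ => white e p.1) ⊤ (S m)}) ∪
      {S | (∀ m, WellConditioned (fun p : Vec d × ℝ => white e p.1) ⊤ (S m)) ∧
      ∃ (V : Vec (2 * K) →L[ℝ] Vec d) (R : PiLp 2 fun _ : Fin M => Vec (2 * K)),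
        8 * μ.σ * √(n * L) * ‖V‖ * ‖R‖ < μ.sourceNoise (white e) S V R} := by
    intro S hS
    by_cases hW : ∀ m, WellConditioned (fun p : Vec d × ℝ => white e p.1) ⊤ (S m)
    · right
      refine ⟨hW, ?_⟩
      by_contra! hcon
      exact hS ⟨hW, hcon⟩
    · left
      push Not at hW
      exact Set.mem_iUnion.2 hW
  have hdesign : ∀ m : Fin M, μ.sourceLaw n {S : SourceData d M n |
        ¬ WellConditioned (fun p : Vec d × ℝ => white e p.1) ⊤ (S m)}
      ≤ ENNReal.ofReal (25 ^ d * Real.exp (-(concentrationRate lam₀ * n))) := by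
    intro m
    have h1 := (he.isIsotropic h hlam m.castSucc).measure_not_wellConditioned_le (by positivity)
      (by positivity) ⊤ n
    rw [finrank_top, finrank_euclideanSpace_fin] at h1
    refine le_trans ?_ h1
    have hmp := measurePreserving_eval
      (fun m : Fin M => Measure.pi fun _ : Fin n => μ.taskLaw m.castSucc) m
    -- `Measure.le_map_apply` holds for arbitrary sets, so measurability of the ill-conditioned
    -- event is not required.
    rw [← hmp.map_eq]
    exact Measure.le_map_apply hmp.aemeasurable _
  have hnoise := μ.measure_source_noise_le h hσ (continuous_white e).measurable (2 * K) hn hL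
  rw [finrank_euclideanSpace_fin] at hnoise
  refine (measure_mono hsub).trans ((measure_union_le _ _).trans (add_le_add ?_ hnoise))
  refine (measure_iUnion_fintype_le _ _).trans ((Finset.sum_le_sum fun m _ => hdesign m).trans ?_)
  simp

variable (μ)

/-- The pairs of a representation and of target data for which the design is ill-conditioned on
the span of the representation and the true regression vector, or the noise is large there. -/
def targetBad (e : Vec d ≃ₗ[ℝ] Vec d) (a : ℝ) (n : ℕ) :
    Set ((Fin d → Fin K → ℝ) × TargetData d n) :=
  {p | ∃ q : Vec K × ℝ,
    ∑ i, inner ℝ (μ.span e (Matrix.of p.1) q) (white e (p.2 i).1) ^ 2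
      < n / 2 * ‖μ.span e (Matrix.of p.1) q‖ ^ 2 ∨
    2 * n * ‖μ.span e (Matrix.of p.1) q‖ ^ 2
      < ∑ i, inner ℝ (μ.span e (Matrix.of p.1) q) (white e (p.2 i).1) ^ 2 ∨
    a * ‖μ.span e (Matrix.of p.1) q‖ < ∑ i, μ.noise (Fin.last M) (p.2 i) *
      inner ℝ (μ.span e (Matrix.of p.1) q) (white e (p.2 i).1)}

/-- Parametrising the span by `q` in a fixed space turns the bad set into a union of strict
inequalities between continuous functions of `(B, T)`. Openness gives the joint measurability needed
to integrate over the target data first. -/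
lemma isOpen_targetBad (e : Vec d ≃ₗ[ℝ] Vec d) (a : ℝ) (n : ℕ) : IsOpen (μ.targetBad e a n) := by
  have hset : μ.targetBad e a n = ⋃ q : Vec K × ℝ,
    ({p | ∑ i, inner ℝ (μ.span e (Matrix.of p.1) q) (white e (p.2 i).1) ^ 2
      < n / 2 * ‖μ.span e (Matrix.of p.1) q‖ ^ 2} ∪
    ({p | 2 * n * ‖μ.span e (Matrix.of p.1) q‖ ^ 2
      < ∑ i, inner ℝ (μ.span e (Matrix.of p.1) q) (white e (p.2 i).1) ^ 2} ∪
    {p | a * ‖μ.span e (Matrix.of p.1) q‖ < ∑ i, μ.noise (Fin.last M) (p.2 i) *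
      inner ℝ (μ.span e (Matrix.of p.1) q) (white e (p.2 i).1)})) := by
    ext p
    simp only [targetBad, Set.mem_ofPred_eq, Set.mem_iUnion, Set.mem_union]
  rw [hset]
  refine isOpen_iUnion fun q => ?_
  have he : Continuous e := (e : Vec d →ₗ[ℝ] Vec d).continuous_of_finiteDimensional
  have hv : Continuous fun p : (Fin d → Fin K → ℝ) × TargetData d n =>
      μ.span e (Matrix.of p.1) q := by
    simp only [span_apply, coef_apply]
    refine he.comp (Continuous.add ?_ continuous_const)
    refine (PiLp.continuous_toLp 2 _).comp ?_
    exact Continuous.matrix_mulVec (A := fun p : (Fin d → Fin K → ℝ) × TargetData d n =>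
      (Matrix.of p.1 : Matrix (Fin d) (Fin K) ℝ)) continuous_fst continuous_const
  have hx : ∀ i, Continuous fun p : (Fin d → Fin K → ℝ) × TargetData d n => p.2 i :=
    fun i => (continuous_apply i).comp continuous_snd
  have hf : ∀ i, Continuous fun p : (Fin d → Fin K → ℝ) × TargetData d n =>
      inner ℝ (μ.span e (Matrix.of p.1) q) (white e (p.2 i).1) := fun i =>
    hv.inner ((continuous_white e).comp (continuous_fst.comp (hx i)))
  have hQ := continuous_finsetSum Finset.univ fun i _ => (hf i).pow 2
  have hZ := continuous_finsetSum Finset.univ fun i _ =>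
    ((μ.continuous_noise (Fin.last M)).comp (hx i)).mul (hf i)
  have hN := hv.norm.pow 2
  exact (isOpen_lt hQ (continuous_const.mul hN)).union
    ((isOpen_lt (continuous_const.mul hN) hQ).union
      (isOpen_lt (continuous_const.mul hv.norm) hZ))

variable {μ}

lemma wellConditioned_of_notMem_targetBad {a : ℝ} {B : Fin d → Fin K → ℝ} {T : TargetData d n}
    (hT : (B, T) ∉ μ.targetBad e a n) :
    WellConditioned (fun p : Vec d × ℝ => white e p.1)
      (LinearMap.range (μ.span e (Matrix.of B))) T ∧
    ∀ v ∈ LinearMap.range (μ.span e (Matrix.of B)),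
      ∑ i, μ.noise (Fin.last M) (T i) * inner ℝ v (white e (T i).1) ≤ a * ‖v‖ := by
  simp only [targetBad, Set.mem_ofPred_eq, not_exists, not_or, not_lt] at hT
  constructor
  · rintro v ⟨q, rfl⟩
    exact ⟨(hT q).1, (hT q).2.1⟩
  · rintro v ⟨q, rfl⟩
    exact (hT q).2.2

lemma IsWhitening.measure_targetBad_le (he : μ.IsWhitening lam₀ e)
    (h : μ.IsLinearSetting lam₀ σ₀) (hlam : 0 < lam₀) (hσ : 0 < μ.σ) (hn : 0 < n) {L : ℝ}
    (hL : 0 < L) (B : Fin d → Fin K → ℝ) :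
    μ.targetLaw n {T | (B, T) ∈ μ.targetBad e (4 * μ.σ * √(n * L)) n}
      ≤ ENNReal.ofReal (25 ^ (K + 1) * Real.exp (-(concentrationRate lam₀ * n)))
        + ENNReal.ofReal (5 ^ (K + 1) * Real.exp (-L)) := by
  have := μ.isProbabilityMeasure_taskLaw h
  set S := LinearMap.range (μ.span e (Matrix.of B)) with hS
  have hrank : Module.finrank ℝ S ≤ K + 1 := μ.finrank_range_span_le _
  have hsub : {T | (B, T) ∈ μ.targetBad e (4 * μ.σ * √(n * L)) n} ⊆
      {T | ¬ WellConditioned (fun p : Vec d × ℝ => white e p.1) S T} ∪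
      {T | WellConditioned (fun p : Vec d × ℝ => white e p.1) S T ∧
      ∃ v ∈ S, 4 * μ.σ * √(n * L) * ‖v‖
        < ∑ i, μ.noise (Fin.last M) (T i) * inner ℝ v (white e (T i).1)} := by
    rintro T ⟨q, hq⟩
    by_cases hW : WellConditioned (fun p : Vec d × ℝ => white e p.1) S T
    · right
      have h1 := hW (μ.span e (Matrix.of B) q) (LinearMap.mem_range_self _ q)
      rcases hq with hq | hq | hq
      · exact absurd hq (not_lt.2 h1.1)
      · exact absurd hq (not_lt.2 h1.2)
      · exact ⟨hW, _, LinearMap.mem_range_self _ q, hq⟩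
    · exact Or.inl hW
  have hdesign := (he.isIsotropic h hlam (Fin.last M)).measure_not_wellConditioned_le
    (by positivity) (by positivity) S n
  have hnoise := μ.measure_target_noise_le h hσ (continuous_white e).measurable S hn hL
  refine (measure_mono hsub).trans ((measure_union_le _ _).trans (add_le_add ?_ ?_))
  · refine hdesign.trans (ENNReal.ofReal_le_ofReal ?_)
    exact mul_le_mul_of_nonneg_right (pow_le_pow_right₀ (by norm_num) hrank) (Real.exp_pos _).le
  · refine hnoise.trans (ENNReal.ofReal_le_ofReal ?_)
    exact mul_le_mul_of_nonneg_right (pow_le_pow_right₀ (by norm_num) hrank) (Real.exp_pos _).le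

/-- The excess risk of the two-stage estimator off the bad events. -/
lemma IsWhitening.excessRisk_le (he : μ.IsWhitening lam₀ e)
    (h : μ.IsLinearSetting lam₀ σ₀) {ν : Vec M} (hν : μ.IsTaskRelevance ν) {nT : ℕ} (hn : 0 < n)
    (hnT : 0 < nT) {Bhat : SourceData d M n → Fin d → Fin K → ℝ}
    {what : SourceData d M n → TargetData d nT → Vec K} (hERM : IsERM Bhat what)
    {a b : ℝ} (ha : 0 ≤ a) {S : SourceData d M n} {T : TargetData d nT}
    (hS : S ∉ μ.sourceBad e a n) (hT : (Bhat S, T) ∉ μ.targetBad e b nT) :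
    μ.excessRisk (Matrix.of (Bhat S)) (what S T)
      ≤ 66 * (‖ν‖ ^ 2 * (16 * a ^ 2 / n ^ 2)) + 128 * b ^ 2 / nT ^ 2 := by
  rw [sourceBad, Set.mem_ofPred_eq, not_not] at hS
  obtain ⟨hSW, hSN⟩ := hS
  obtain ⟨W, hW⟩ := hERM.source S (exists_isSourceMinimizer e hn hSW)
  have h1 := μ.sum_norm_sq_le_of_isSourceMinimizer hn hSW hSN ha hW
  obtain ⟨w', hw'⟩ := hν.exists_norm_sq_le (e := e) (Matrix.of (Bhat S)) W
  obtain ⟨hTW, hTN⟩ := wellConditioned_of_notMem_targetBad hT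
  have h2 := μ.norm_sq_le_of_targetLoss_le hnT hTW hTN (hERM.target S T w')
  rw [he.excessRisk_eq h]
  have h3 := mul_le_mul_of_nonneg_left h1 (sq_nonneg ‖ν‖)
  linarith

/-- The probability of a large excess risk of the two-stage estimator. -/
theorem IsWhitening.measure_excessRisk_le (he : μ.IsWhitening lam₀ e)
    (h : μ.IsLinearSetting lam₀ σ₀) (hlam : 0 < lam₀) (hσ : 0 < μ.σ) {ν : Vec M}
    (hν : μ.IsTaskRelevance ν) {nT : ℕ} (hn : 0 < n) (hnT : 0 < nT)
    {Bhat : SourceData d M n → Fin d → Fin K → ℝ}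
    {what : SourceData d M n → TargetData d nT → Vec K} (hERM : IsERM Bhat what)
    {L L' : ℝ} (hL : 0 < L) (hL' : 0 < L') :
    μ.sampleLaw n nT {D | 66 * (‖ν‖ ^ 2 * (1024 * μ.σ ^ 2 * L / n)) + 2048 * μ.σ ^ 2 * L' / nT
        < μ.excessRisk (Matrix.of (Bhat D.1)) (what D.1 D.2)}
      ≤ (M * ENNReal.ofReal (25 ^ d * Real.exp (-(concentrationRate lam₀ * n)))
        + ENNReal.ofReal (5 ^ (2 * K * d + M * (2 * K)) * Real.exp (-L)))
        + (ENNReal.ofReal (25 ^ (K + 1) * Real.exp (-(concentrationRate lam₀ * nT)))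
        + ENNReal.ofReal (5 ^ (K + 1) * Real.exp (-L'))) := by
  have := μ.isProbabilityMeasure_sourceLaw h n
  have := μ.isProbabilityMeasure_targetLaw h nT
  have hn' : (0 : ℝ) < n := by exact_mod_cast hn
  have hnT' : (0 : ℝ) < nT := by exact_mod_cast hnT
  set a := 8 * μ.σ * √(n * L) with ha
  set b := 4 * μ.σ * √(nT * L') with hb
  have ha2 : 16 * a ^ 2 / (n : ℝ) ^ 2 = 1024 * μ.σ ^ 2 * L / n := by
    rw [ha, mul_pow, Real.sq_sqrt (by positivity)]; field_simp; norm_num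
  have hb2 : 128 * b ^ 2 / (nT : ℝ) ^ 2 = 2048 * μ.σ ^ 2 * L' / nT := by
    rw [hb, mul_pow, Real.sq_sqrt (by positivity)]; field_simp; norm_num
  -- This event depends on the source data only through `Bhat`, whose measurability makes it
  -- measurable; `what` does not enter.
  set TB : Set (SourceData d M n × TargetData d nT) :=
    (fun D => (Bhat D.1, D.2)) ⁻¹' μ.targetBad e b nT with hTB
  have hTBm : MeasurableSet TB :=
    ((hERM.measurable.comp measurable_fst).prodMk measurable_snd)
      (μ.isOpen_targetBad e b nT).measurableSet
  have hsub : {D : SourceData d M n × TargetData d nT |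
      66 * (‖ν‖ ^ 2 * (1024 * μ.σ ^ 2 * L / n)) + 2048 * μ.σ ^ 2 * L' / nT
        < μ.excessRisk (Matrix.of (Bhat D.1)) (what D.1 D.2)}
      ⊆ (μ.sourceBad e a n ×ˢ Set.univ) ∪ TB := by
    rintro ⟨S, T⟩ hD
    by_contra hcon
    rw [Set.mem_union, not_or] at hcon
    have hS : S ∉ μ.sourceBad e a n := fun hS => hcon.1 ⟨hS, trivial⟩
    have := he.excessRisk_le h hν hn hnT hERM (by positivity) hS hcon.2
    rw [ha2, hb2] at this
    exact absurd hD (not_lt.2 this)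
  rw [sampleLaw_eq]
  refine (measure_mono hsub).trans ((measure_union_le _ _).trans (add_le_add ?_ ?_))
  · rw [Measure.prod_prod, measure_univ, mul_one]
    exact he.measure_sourceBad_le h hlam hσ hn hL
  · rw [Measure.prod_apply hTBm]
    -- For fixed source data the representation is deterministic, so the bound for a fixed `B` holds
    -- on every slice.
    refine (lintegral_mono fun S => he.measure_targetBad_le h hlam hσ hnT hL' (Bhat S)).trans ?_
    simp

end Model

end Events

/-! ### Sample sizes -/

lemma pow_mul_exp_neg_le {b c x η : ℝ} {k : ℕ} (hb0 : 0 ≤ b) (hb : b ≤ Real.exp c) (hη : 0 < η)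
    (hx : c * k + Real.log (1 / η) ≤ x) : b ^ k * Real.exp (-x) ≤ η := by
  calc b ^ k * Real.exp (-x) ≤ Real.exp c ^ k * Real.exp (-x) := by gcongr
    _ = Real.exp (c * k - x) := by rw [← Real.exp_nat_mul, ← Real.exp_add]; congr 1; ring
    _ ≤ Real.exp (Real.log η) := by
        rw [one_div, Real.log_inv] at hx
        exact Real.exp_le_exp.2 (by linarith)
    _ = η := Real.exp_log hη

lemma five_le_exp_two : (5 : ℝ) ≤ Real.exp 2 := by
  have h := Real.exp_one_gt_d9
  have h2 : Real.exp 2 = Real.exp 1 ^ 2 := by rw [← Real.exp_nat_mul]; norm_num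
  rw [h2]
  nlinarith

lemma twentyFive_le_exp_four : (25 : ℝ) ≤ Real.exp 4 := by
  have h2 : Real.exp 4 = Real.exp 2 ^ 2 := by rw [← Real.exp_nat_mul]; norm_num
  rw [h2]
  nlinarith [five_le_exp_two]

lemma log_four_div_le {x : ℝ} (hx : 0 < x) : Real.log (4 / x) ≤ 2 + Real.log (1 / x) := by
  have h4 : Real.log 4 ≤ 2 := by
    rw [Real.log_le_iff_le_exp (by norm_num)]
    linarith [five_le_exp_two]
  rw [Real.log_div (by norm_num) hx.ne', one_div, Real.log_inv]
  linarith

/-- There are no unit vectors in `ℝ⁰` and the infimum of the empty set is 0 by default, so diversity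
forces `K > 0`. -/
lemma sigmaMin_zero_rows {M : ℕ} (W : Matrix (Fin 0) (Fin M) ℝ) : sigmaMin W = 0 := by
  have h : {r : ℝ | ∃ u : Vec 0, ‖u‖ = 1 ∧ r = ‖rep W u‖} = ∅ := by
    rw [Set.eq_empty_iff_forall_notMem]
    rintro r ⟨u, hu, -⟩
    rw [Subsingleton.elim u 0, norm_zero] at hu
    exact zero_ne_one hu
  rw [sigmaMin, h, Real.sInf_empty]

lemma excessRisk_zero_dim {K M : ℕ} (μ : Model 0 K M) (B : Matrix (Fin 0) (Fin K) ℝ) (w : Vec K) :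
    μ.excessRisk B w = 0 := by
  have h : ∀ (B : Matrix (Fin 0) (Fin K) ℝ) (x : Vec 0), rep B x = 0 := by
    intro B x
    ext k
    simp [rep]
  simp [Model.excessRisk, Model.targetRisk, h]

end RepLearning

open RepLearning in
theorem mainTheorem2 :
    ∃ (p : ℕ) (C : ℝ), 0 < C ∧
      ∀ (lam₀ σ₀ : ℝ), 0 < lam₀ → 0 < σ₀ →
        ∃ C₀ : ℝ, 0 < C₀ ∧
          ∀ (d K M : ℕ) (μ : RepLearning.Model d K M) (ν : RepLearning.Vec M) (ε δ : ℝ)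
            (N nT : ℕ),
            μ.IsLinearSetting lam₀ σ₀ →
            μ.IsTaskRelevance ν →
            0 < ε → ε ≤ 1 → 0 < δ → δ < 1 →
            C₀ * (M * (d + Real.log (M / δ))) ≤ N →
            C * RepLearning.logFactor d K M N ε ^ p *
                ((K * d + K * M + Real.log (1 / δ)) * μ.σ ^ 2 * M * ‖ν‖ ^ 2 / ε ^ 2) ≤ N →
            C₀ * RepLearning.logFactor d K M N ε ^ p *
                (μ.σ ^ 2 * (K + Real.log (1 / δ)) / ε ^ 2) ≤ nT →
            ∀ (Bhat : RepLearning.SourceData d M (N / M) → Fin d → Fin K → ℝ)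
              (what : RepLearning.SourceData d M (N / M) → RepLearning.TargetData d nT →
                RepLearning.Vec K),
              RepLearning.IsERM Bhat what →
              μ.sampleLaw (N / M) nT
                  {D | ε ^ 2 < μ.excessRisk (Matrix.of (Bhat D.1)) (what D.1 D.2)}
                ≤ ENNReal.ofReal δ := by
  refine ⟨0, 2000000, by norm_num, fun lam₀ σ₀ hlam hσ₀ => ?_⟩
  have hc := Model.concentrationRate_pos hlam
  set c := Model.concentrationRate lam₀ with hcdef
  -- The three terms serve, in order, the target noise, the conditioning of the source designs and
  -- the conditioning of the target design.
  refine ⟨25000 + 12 / c + 10 / (c * σ₀ ^ 2), by positivity, ?_⟩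
  intro d K M μ ν ε δ N nT h hν hε hε1 hδ hδ1 hN1 hN2 hnT Bhat what hERM
  set C₀ := 25000 + 12 / c + 10 / (c * σ₀ ^ 2) with hC₀
  have hC₀a : 25000 ≤ C₀ := by
    have : 0 < 12 / c + 10 / (c * σ₀ ^ 2) := by positivity
    linarith
  have hC₀b : 12 ≤ C₀ * c := by
    have h1 : 12 / c ≤ C₀ := by
      have : 0 < 10 / (c * σ₀ ^ 2) := by positivity
      linarith
    rwa [div_le_iff₀ hc] at h1
  have hC₀c : 10 ≤ C₀ * (c * σ₀ ^ 2) := by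
    have h1 : 10 / (c * σ₀ ^ 2) ≤ C₀ := by
      have : 0 < 12 / c := by positivity
      linarith
    rwa [div_le_iff₀ (by positivity)] at h1
  rw [pow_zero, mul_one] at hN2 hnT
  rcases Nat.eq_zero_or_pos d with rfl | hd
  · simp [excessRisk_zero_dim, not_lt.2 (sq_nonneg ε)]
  have hK : 0 < K := by
    rcases Nat.eq_zero_or_pos K with rfl | hK
    · exact absurd h.diverse (by rw [sigmaMin_zero_rows]; exact lt_irrefl 0)
    · exact hK
  have hM : 0 < M := hK.trans_le h.le_sources
  have hd' : (1 : ℝ) ≤ d := by exact_mod_cast hd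
  have hK' : (1 : ℝ) ≤ K := by exact_mod_cast hK
  have hM' : (1 : ℝ) ≤ M := by exact_mod_cast hM
  have hσ : 0 < μ.σ := hσ₀.trans_le h.noise_lower
  have hℓ : 0 < Real.log (1 / δ) := Real.log_pos (by rw [lt_div_iff₀ hδ]; linarith)
  set ℓ := Real.log (1 / δ) with hℓdef
  have hℓM : 0 ≤ Real.log (M / δ) :=
    Real.log_nonneg (by rw [le_div_iff₀ hδ]; linarith)
  set ℓM := Real.log (M / δ) with hℓMdef
  have hlog4 : Real.log (4 / δ) ≤ 2 + ℓ := log_four_div_le hδ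
  have hlog4pos : 0 < Real.log (4 / δ) := Real.log_pos (by rw [lt_div_iff₀ hδ]; linarith)
  -- the number of samples per source task
  have hNM : M ≤ N := by
    have h1 : (M : ℝ) * 1 ≤ M * (d + ℓM) := by gcongr; linarith
    have h2 : 1 * (M * (d + ℓM)) ≤ C₀ * (M * (d + ℓM)) := by gcongr; linarith
    have h3 : (M : ℝ) ≤ N := by linarith
    exact_mod_cast h3
  set n := N / M with hndef
  have hn : 0 < n := Nat.div_pos hNM hM
  have hn' : (1 : ℝ) ≤ n := by exact_mod_cast hn
  -- Rounding down to `N / M` costs at most a factor 2, since `n ≥ 1`.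
  have hNn : (N : ℝ) ≤ 2 * (M * n) := by
    have h1 : N < M * (n + 1) := by
      rw [mul_comm]; exact Nat.lt_mul_of_div_lt (Nat.lt_succ_self _) hM
    have h2 : N ≤ 2 * (M * n) := by nlinarith
    exact_mod_cast h2
  have hnlow : C₀ * (d + ℓM) ≤ 2 * n := by
    have h1 : (M : ℝ) * (C₀ * (d + ℓM)) ≤ M * (2 * n) := by linarith
    exact le_of_mul_le_mul_left h1 (by linarith)
  have hcn : 6 * (d + ℓM) ≤ c * n := by
    have h1 := mul_le_mul_of_nonneg_left hnlow hc.le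
    have h2 := mul_le_mul_of_nonneg_right hC₀b (show 0 ≤ d + ℓM by linarith)
    linarith
  -- the number of target samples
  have hnT0 : 0 < C₀ * (μ.σ ^ 2 * (K + ℓ) / ε ^ 2) := by positivity
  have hnT' : (0 : ℝ) < nT := hnT0.trans_le hnT
  have hnTpos : 0 < nT := by exact_mod_cast hnT'
  -- The target budget scales as `σ² / ε²`; the bounds `σ ≥ σ₀` and `ε ≤ 1` turn it into a bound
  -- that also controls the design.
  have hcnT : 10 * (K + ℓ) ≤ c * nT := by
    have h1 : μ.σ ^ 2 * (K + ℓ) ≤ μ.σ ^ 2 * (K + ℓ) / ε ^ 2 := by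
      rw [le_div_iff₀ (by positivity)]
      exact mul_le_of_le_one_right (by positivity) (pow_le_one₀ hε.le hε1)
    have h2 : σ₀ ^ 2 * (K + ℓ) ≤ μ.σ ^ 2 * (K + ℓ) := by
      have := h.noise_lower
      gcongr
    have h3 : c * (C₀ * (σ₀ ^ 2 * (K + ℓ))) ≤ c * nT := by
      refine mul_le_mul_of_nonneg_left (le_trans ?_ hnT) hc.le
      exact mul_le_mul_of_nonneg_left (h2.trans h1) (by linarith)
    have h4 := mul_le_mul_of_nonneg_right hC₀c (show 0 ≤ K + ℓ by linarith)
    linarith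
  obtain ⟨e, he⟩ := h.exists_isWhitening hlam
  -- Since `5 ≤ e²`, twice the net dimension pays for the union bound, and `log (4 / δ)` leaves
  -- failure probability `δ / 4`.
  set L : ℝ := 2 * ((2 * K * d + M * (2 * K) : ℕ) : ℝ) + Real.log (4 / δ) with hLdef
  set L' : ℝ := 2 * ((K + 1 : ℕ) : ℝ) + Real.log (4 / δ) with hL'def
  have hL : 0 < L := by positivity
  have hL' : 0 < L' := by positivity
  have hLle : L ≤ 6 * (K * d + K * M + ℓ) := by
    have h1 : (1 : ℝ) ≤ K * M := by nlinarith
    have h2 : (0 : ℝ) ≤ K * d := by positivity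
    rw [hLdef]; push_cast
    linarith
  have hL'le : L' ≤ 6 * (K + ℓ) := by
    rw [hL'def]; push_cast
    linarith
  have key := he.measure_excessRisk_le h hlam hσ hν hn hnTpos hERM hL hL'
  -- The source term is at most `66 · 12288 / 2000000 < 0.41` times `ε²`, and the target term at
  -- most `12288 / 25000 < 0.5` times `ε²`.
  have hrisk : 66 * (‖ν‖ ^ 2 * (1024 * μ.σ ^ 2 * L / n)) + 2048 * μ.σ ^ 2 * L' / nT ≤ ε ^ 2 := by
    have h1 : ‖ν‖ ^ 2 * (1024 * μ.σ ^ 2 * L / n) ≤ 12288 / 2000000 * ε ^ 2 := by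
      have h2 : 2000000 * ((K * d + K * M + ℓ) * μ.σ ^ 2 * M * ‖ν‖ ^ 2) ≤ N * ε ^ 2 := by
        have h3 := hN2
        rw [← mul_div_assoc, div_le_iff₀ (by positivity)] at h3
        exact h3
      have h4 : N * ε ^ 2 ≤ 2 * (M * n) * ε ^ 2 := by gcongr
      have h5 : (M : ℝ) * (1000000 * ((K * d + K * M + ℓ) * μ.σ ^ 2 * ‖ν‖ ^ 2))
          ≤ M * (n * ε ^ 2) := by linarith
      have h6 := le_of_mul_le_mul_left h5 (by linarith)
      have h7 : ‖ν‖ ^ 2 * (1024 * μ.σ ^ 2 * L / n) = 1024 * (L * (μ.σ ^ 2 * ‖ν‖ ^ 2)) / n := by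
        ring
      rw [h7, div_le_iff₀ (by linarith)]
      have h8 := mul_le_mul_of_nonneg_right hLle (show 0 ≤ μ.σ ^ 2 * ‖ν‖ ^ 2 by positivity)
      linarith
    have h2 : 2048 * μ.σ ^ 2 * L' / nT ≤ 12288 / 25000 * ε ^ 2 := by
      rw [div_le_iff₀ hnT']
      have h3 : 25000 * (μ.σ ^ 2 * (K + ℓ)) ≤ nT * ε ^ 2 := by
        rw [← div_le_iff₀ (by positivity)]
        refine le_trans ?_ hnT
        rw [mul_div_assoc]
        gcongr
      have h4 := mul_le_mul_of_nonneg_left hL'le (sq_nonneg μ.σ)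
      linarith
    have h3 : 0 ≤ ε ^ 2 := sq_nonneg ε
    linarith
  refine le_trans (measure_mono fun D hD => lt_of_le_of_lt hrisk hD) (key.trans ?_)
  -- Each of the four failure events receives `δ / 4`; this one is shared among the `M` source
  -- designs, which is why `log (M / δ)` appears in the first budget condition.
  have hb1 : 25 ^ d * Real.exp (-(c * n)) ≤ δ / (4 * M) := by
    refine pow_mul_exp_neg_le (by norm_num) twentyFive_le_exp_four (by positivity) ?_
    have h1 : 1 / (δ / (4 * M)) = 4 / (δ / M) := by field_simp
    have h2 := log_four_div_le (show 0 < δ / M by positivity)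
    have h3 : 1 / (δ / M) = M / δ := by field_simp
    rw [h3] at h2
    rw [h1]
    linarith
  have hb2 : 5 ^ (2 * K * d + M * (2 * K)) * Real.exp (-L) ≤ δ / 4 := by
    refine pow_mul_exp_neg_le (by norm_num) five_le_exp_two (by positivity) ?_
    rw [one_div_div]
  have hb3 : 25 ^ (K + 1) * Real.exp (-(c * nT)) ≤ δ / 4 := by
    refine pow_mul_exp_neg_le (by norm_num) twentyFive_le_exp_four (by positivity) ?_
    rw [one_div_div]
    push_cast
    linarith
  have hb4 : 5 ^ (K + 1) * Real.exp (-L') ≤ δ / 4 := by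
    refine pow_mul_exp_neg_le (by norm_num) five_le_exp_two (by positivity) ?_
    rw [one_div_div]
  have hb1' : (M : ENNReal) * ENNReal.ofReal (25 ^ d * Real.exp (-(c * n)))
      ≤ ENNReal.ofReal (δ / 4) := by
    rw [← ENNReal.ofReal_natCast, ← ENNReal.ofReal_mul (Nat.cast_nonneg _)]
    refine ENNReal.ofReal_le_ofReal ?_
    calc (M : ℝ) * (25 ^ d * Real.exp (-(c * n))) ≤ M * (δ / (4 * M)) := by gcongr
      _ = δ / 4 := by field_simp
  calc _ ≤ (ENNReal.ofReal (δ / 4) + ENNReal.ofReal (δ / 4))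
        + (ENNReal.ofReal (δ / 4) + ENNReal.ofReal (δ / 4)) :=
        add_le_add (add_le_add hb1' (ENNReal.ofReal_le_ofReal hb2))
          (add_le_add (ENNReal.ofReal_le_ofReal hb3) (ENNReal.ofReal_le_ofReal hb4))
    _ = ENNReal.ofReal δ := by
        have h4 : 0 ≤ δ / 4 := by positivity
        rw [← ENNReal.ofReal_add h4 h4, ← ENNReal.ofReal_add (by positivity) (by positivity)]
        congr 1; ring
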